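/- **Conventions.** All graphs are simple and undirected, $\mathbb N=\{0,1,2,\dots\}$, and $q\in\mathbb N$ is identified with $\{0,\dots,q-1\}$. $B_G(v,R)$ is the set of vertices reachable from $v$ by a path of at most $R$ edges of $G$. *Structured graphs.* A structured graph $\boldsymbol G=(G,\sigma)$ is a graph $G$ with a partial function $\sigma$ from finite tuples of vertices of $G$ to $\mathbb N$ whose domain contains only tuples of length at most some $\ell\in\mathbb N$. For $U\subseteq V(G)$, the induced structured graph $\boldsymbol G[U]$ is $G[U]$ together with the restriction of $\sigma$ to tuples from $U$; isomorphisms must preserve structure maps. $\boldsymbol G$ is Borel if $V(G)$ is a standard Borel space, the adjacency relation is a Borel subset of $V(G)^2$, and each $\sigma^{-1}(i)$, $i\in\mathbb N$, is a Borel set of tuples. For $f\colon V(G)\to\mathbb N$, $v\in V(G)$ and $R\in\mathbb N$ such that $B_G(v,R)$ is finite, $[\boldsymbol G,f,v]_R$ denotes the isomorphism type of the rooted labeled structured graph $(\boldsymbol G[B_G(v,R)],\,f|_{B_G(v,R)},\,v)$. *LCL problems and complexity.* An LCL problem is a pair $\Pi=(R,\mathcal P)$ with $R\in\mathbb N$ and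 $\mathcal P$ a map from isomorphism types of finite rooted labeled structured graphs to $\{0,1\}$. A function $f\colon V(\boldsymbol G)\to\mathbb N$ on a locally finite structured graph is a $\Pi$-coloring of $\boldsymbol G$ if $\mathcal P([\boldsymbol G,f,v]_R)=1$ for all $v$. A $\mathsf{LOCAL}$ algorithm is a map $\mathcal A$ from isomorphism types of finite rooted labeled structured graphs to $\mathbb N$, and $\mathcal A_T(\boldsymbol G,f)(v):=\mathcal A([\boldsymbol G,f,v]_T)$. For a class $\mathbb G$ of finite structured graphs and $n\ge 1$, $\mathsf{Rand}_{\Pi,\mathbb G}(n)\in\mathbb N\cup\{\infty\}$ is the least $T\in\mathbb N$ for which there are an integer $\ell\ge1$ and a $\mathsf{LOCAL}$ algorithm $\mathcal A$ such that for every $n$-vertex $\boldsymbol H\in\mathbb G$ and uniformly random $\theta\colon V(\boldsymbol H)\to\ell$, $$\mathbb P\big[\mathcal A_T(\boldsymbol H,\theta)\text{ is a }\Pi\text{-coloring of }\boldsymbol H\big]\ \ge\ 1-\tfrac1n,$$ and it is $\infty$ if there is no such $T$. *Locality.* $\boldsymbol G$ is $(R,n)$-locally in $\mathbb G$ if for every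 $v\in V(\boldsymbol G)$ there are an $n$-vertex $\boldsymbol H\in\mathbb G$ and $u\in V(\boldsymbol H)$ with $(\boldsymbol G[B_{\boldsymbol G}(v,R)],v)\cong(\boldsymbol H[B_{\boldsymbol H}(u,R)],u)$ as rooted structured graphs. *Asymptotic separation index.* $\mathsf{si}(G)$ is the least $s\in\mathbb N$ such that $V(G)$ has a partition into $s+1$ Borel sets $U_0,\dots,U_s$ (possibly empty) for which all connected components of each $G[U_i]$ are finite ($\infty$ if there is no such $s$). $\mathsf{asi}(G)=\sup_{R\in\mathbb N}\mathsf{si}(G^R)$, where $G^R$ joins distinct vertices connected by a path of at most $R$ edges in $G$; $\mathsf{asi}(\boldsymbol G):=\mathsf{asi}(G)$. **Theorem 3.6.** Let $\Pi=(R,\mathcal P)$ be an LCL problem and let $\mathbb G$ be a class of finite structured graphs. Fix an integer $n\ge1$ with $\mathsf{Rand}_{\Pi,\mathbb G}(n)<\infty$ and set $R^*:=\mathsf{Rand}_{\Pi,\mathbb G}(n)+R$. Suppose that $\boldsymbol G$ is a Borel structured graph such that - $\boldsymbol G$ is $(R^*,n)$-locally in $\mathbb G$, - $\mathsf{asi}(\boldsymbol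 G)\le s<\infty$ for some $s\in\mathbb N$, and - $|B_{\boldsymbol G}(v,2R^*)|\le n^{1/(s+1)}/e$ for all $v\in V(\boldsymbol G)$. Then $\boldsymbol G$ has a Borel $\Pi$-coloring, i.e. a $\Pi$-coloring $f\colon V(\boldsymbol G)\to\mathbb N$ with $f^{-1}(i)$ Borel for every $i\in\mathbb N$. -/

import Mathlib

/-
Structured graphs, LCL problems, randomized LOCAL complexity, Borel structured graphs,
and the asymptotic separation index.
-/

universe u v

noncomputable section

namespace BorelLocal

/-! ### Graphs: balls, powers, component-finiteness -/

/-- The `R`-ball around `v`: all vertices reachable from `v` along at most `R` edges. -/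
def ball {V : Type u} (G : SimpleGraph V) (v : V) (R : ℕ) : Set V :=
  {u | ∃ p : G.Walk v u, p.length ≤ R}

/-- The root belongs to its ball. -/
theorem mem_ball_self {V : Type u} (G : SimpleGraph V) (v : V) (R : ℕ) : v ∈ ball G v R :=
  ⟨SimpleGraph.Walk.nil, Nat.zero_le R⟩

/-- The power `G^R`: distinct vertices are adjacent when they are joined along at most `R`
edges of `G`. -/
def power {V : Type u} (G : SimpleGraph V) (R : ℕ) : SimpleGraph V where
  Adj u v := u ≠ v ∧ v ∈ ball G u R
  symm := ⟨by
    rintro u v ⟨hne, p, hp⟩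
    exact ⟨hne.symm, p.reverse, by simpa using hp⟩⟩
  loopless := ⟨fun _ h => h.1 rfl⟩

/-- Every connected component is finite. -/
def ComponentFinite {V : Type u} (G : SimpleGraph V) : Prop :=
  ∀ c : G.ConnectedComponent, c.supp.Finite

/-- A Borel partition `V = U_0 ⊔ … ⊔ U_s` with component-finite induced subgraphs `G[U_i]`.
The partition is given by the Borel map `c` sending a vertex to the index of its piece, so
that `U_i = c ⁻¹' {i}`. -/
def HasSeparation {V : Type u} [MeasurableSpace V] (G : SimpleGraph V) (s : ℕ) : Prop :=
  ∃ c : V → Fin (s + 1), Measurable c ∧ ∀ i, ComponentFinite (G.induce (c ⁻¹' {i}))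

/-- The separation index; it is `⊤` when no separation exists. -/
def si {V : Type u} [MeasurableSpace V] (G : SimpleGraph V) : ℕ∞ :=
  ⨅ (s : ℕ) (_ : HasSeparation G s), (s : ℕ∞)

/-- The asymptotic separation index. -/
def asi {V : Type u} [MeasurableSpace V] (G : SimpleGraph V) : ℕ∞ :=
  ⨆ R : ℕ, si (power G R)

/-! ### Structured graphs -/

/-- Finite tuples of elements of `X`. -/
abbrev Tuple (X : Type u) : Type u := Σ k : ℕ, (Fin k → X)

/-- Apply a map to every entry of a tuple. -/
def Tuple.map {X : Type u} {Y : Type v} (g : X → Y) (x : Tuple X) : Tuple Y :=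
  ⟨x.1, fun i => g (x.2 i)⟩

/-- A structured graph on the vertex set `V`: a simple graph with a structure map, that is,
a partial function from finite tuples of vertices to `ℕ` (the value `none` means undefined)
whose domain consists of tuples of bounded length. -/
structure StructuredGraph (V : Type u) where
  graph : SimpleGraph V
  σ : Tuple V → Option ℕ
  bounded : ∃ ℓ : ℕ, ∀ x : Tuple V, σ x ≠ none → x.1 ≤ ℓ

/-- The induced structured graph `G[U]`. -/
def StructuredGraph.induce {V : Type u} (G : StructuredGraph V) (U : Set V) :
    StructuredGraph U where
  graph := G.graph.induce U
  σ x := G.σ (x.map Subtype.val)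
  bounded := by
    obtain ⟨ℓ, hℓ⟩ := G.bounded
    exact ⟨ℓ, fun x hx => hℓ (x.map Subtype.val) hx⟩

/-- Isomorphisms of structured graphs: graph isomorphisms preserving the structure maps
(both their domains and their values). -/
structure StructuredIso {V : Type u} {W : Type v} (G : StructuredGraph V)
    (H : StructuredGraph W) where
  iso : G.graph ≃g H.graph
  map_σ : ∀ x : Tuple V, H.σ (x.map iso) = G.σ x

/-- A structured graph on a measurable space is Borel if the adjacency relation and all the
sets `σ⁻¹(i)` are Borel. (It is to be used on a standard Borel space.) -/
structure StructuredGraph.IsBorel {V : Type u} [MeasurableSpace V] (G : StructuredGraph V) :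
    Prop where
  adj : MeasurableSet {p : V × V | G.graph.Adj p.1 p.2}
  σ : ∀ i : ℕ, MeasurableSet {x : Tuple V | G.σ x = some i}

/-- A finite structured graph. -/
structure FinStructuredGraph : Type (u + 1) where
  V : Type u
  finite : Finite V
  G : StructuredGraph V

/-! ### Isomorphism types of finite rooted labeled structured graphs -/

/-- A finite rooted labeled structured graph. -/
structure RootedLabeled : Type (u + 1) where
  V : Type u
  finite : Finite V
  G : StructuredGraph V
  label : V → ℕ
  root : V

/-- Isomorphism of finite rooted labeled structured graphs. -/
def RootedLabeled.Isomorphic (A B : RootedLabeled.{u}) : Prop :=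
  ∃ e : StructuredIso A.G B.G, e.iso A.root = B.root ∧ ∀ x, B.label (e.iso x) = A.label x

theorem RootedLabeled.isomorphic_equivalence :
    Equivalence RootedLabeled.Isomorphic.{u} where
  refl A := ⟨⟨SimpleGraph.Iso.refl, fun _ => rfl⟩, rfl, fun _ => rfl⟩
  symm := by
    rintro A B ⟨e, hr, hl⟩
    refine ⟨⟨e.iso.symm, fun x => ?_⟩, ?_, fun x => ?_⟩
    · rw [← e.map_σ]
      congr 1
      simp [Tuple.map]
    · rw [← hr]; simp
    · rw [← hl]; simp
  trans := by
    rintro A B C ⟨e, hr, hl⟩ ⟨e', hr', hl'⟩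
    refine ⟨⟨e.iso.trans e'.iso, fun x => ?_⟩, ?_, fun x => ?_⟩
    · rw [← e.map_σ, ← e'.map_σ]; rfl
    · simp [hr, hr']
    · simp [hl, hl']

instance RootedLabeled.setoid : Setoid RootedLabeled.{u} :=
  ⟨RootedLabeled.Isomorphic, RootedLabeled.isomorphic_equivalence⟩

/-- Isomorphism classes of finite rooted labeled structured graphs. -/
abbrev IsoClass : Type (u + 1) := Quotient RootedLabeled.setoid.{u}

/-- The isomorphism type `[G, f, v]_R` of the rooted labeled `R`-ball around `v`
(when this ball is finite). -/
def ballClass {V : Type u} (G : StructuredGraph V) (f : V → ℕ) (v : V) (R : ℕ)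
    (h : (ball G.graph v R).Finite) : IsoClass.{u} :=
  Quotient.mk _
    { V := ball G.graph v R
      finite := h
      G := G.induce (ball G.graph v R)
      label := fun x => f x
      root := ⟨v, mem_ball_self G.graph v R⟩ }

/-! ### LCL problems and LOCAL algorithms -/

/-- A locally checkable labeling problem `Π = (R, 𝒫)`; the value `true` stands for `1`. -/
structure LCL : Type (u + 1) where
  radius : ℕ
  check : IsoClass.{u} → Bool

/-- `f` is a `Π`-coloring of `G`: `𝒫([G, f, v]_R) = 1` for every vertex `v`. (The `R`-balls of
a locally finite graph are finite, so the witness `h` then always exists.) -/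
def LCL.IsColoring (P : LCL.{u}) {V : Type u} (G : StructuredGraph V) (f : V → ℕ) : Prop :=
  ∀ v, ∃ h : (ball G.graph v P.radius).Finite, P.check (ballClass G f v P.radius h) = true

/-- LOCAL algorithms. -/
abbrev LocalAlgorithm : Type (u + 1) := IsoClass.{u} → ℕ

open Classical in
/-- The output `𝒜_T(G, f)` of the algorithm after time `T`. (The value `0` is only used for
an infinite ball, which does not occur in a locally finite graph.) -/
def LocalAlgorithm.output (A : LocalAlgorithm.{u}) (T : ℕ) {V : Type u}
    (G : StructuredGraph V) (f : V → ℕ) (v : V) : ℕ :=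
  if h : (ball G.graph v T).Finite then A (ballClass G f v T h) else 0

/-- The probability that `𝒜_T(H, θ)` is a `Π`-coloring of the finite structured graph `H`, for
a uniformly random `θ : V(H) → {0, …, ℓ - 1}`. -/
def successProb (P : LCL.{u}) (A : LocalAlgorithm.{u}) (T ℓ : ℕ)
    (H : FinStructuredGraph.{u}) : ℝ :=
  (Nat.card {θ : H.V → Fin ℓ //
      P.IsColoring H.G (LocalAlgorithm.output A T H.G (fun x => (θ x : ℕ)))} : ℝ) /
    (Nat.card (H.V → Fin ℓ) : ℝ)

/-- Time `T` suffices to solve `Π` on the `n`-vertex members of `𝔾` by a randomized algorithm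
with failure probability at most `1/n`. -/
def SolvableInTime (P : LCL.{u}) (𝔾 : Set FinStructuredGraph.{u}) (n T : ℕ) : Prop :=
  ∃ ℓ : ℕ, 0 < ℓ ∧ ∃ A : LocalAlgorithm.{u}, ∀ H ∈ 𝔾, Nat.card H.V = n →
    1 - 1 / (n : ℝ) ≤ successProb P A T ℓ H

/-- The randomized LOCAL complexity `Rand_{Π,𝔾}(n)`: the least suitable `T`, or `⊤` if there
is none. -/
def randComplexity (P : LCL.{u}) (𝔾 : Set FinStructuredGraph.{u}) (n : ℕ) : ℕ∞ :=
  ⨅ (T : ℕ) (_ : SolvableInTime P 𝔾 n T), (T : ℕ∞)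

/-- `G` is `(R, n)`-locally in `𝔾`: each rooted `R`-ball of `G` is isomorphic, as a rooted
structured graph, to a rooted `R`-ball of some `n`-vertex member of `𝔾`. -/
def LocallyIn {V : Type u} (G : StructuredGraph V) (R n : ℕ)
    (𝔾 : Set FinStructuredGraph.{u}) : Prop :=
  ∀ v : V, ∃ H ∈ 𝔾, Nat.card H.V = n ∧ ∃ x : H.V,
    ∃ e : StructuredIso (G.induce (ball G.graph v R)) (H.G.induce (ball H.G.graph x R)),
      e.iso ⟨v, mem_ball_self G.graph v R⟩ = ⟨x, mem_ball_self H.G.graph x R⟩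

end BorelLocal

end

/-! Derandomization by the method of conditional probabilities, one piece of a Borel partition at a
time. Take a randomized algorithm `A` running in time `T` with failure probability at most `1/n`.
Whether its output violates the constraint at `v` depends only on the seeds within distance `r =
Rstar` of `v`. That ball also occurs in some `n`-vertex member of the class, so under uniform seeds
each vertex of `G` fails with probability at most `1/n`.

Let `Δ` bound the sizes of the `2r`-balls, and partition `V` into at most `s + 1` Borel pieces on
which `G^{2r}` has finite components. Fix the seeds on one piece after another while tracking the
conditional failure probability at every vertex (`LCL.condFail`). If it is at most `q` everywhere,
Markov's inequality shows that random seeds on the next piece raise it to `e Δ q` or more at a given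
vertex with probability at most `1/(eΔ)`. These events are independent at distance greater than
`2r`, so the symmetric local lemma avoids any finite set of them (`exists_seeds_of_finite`). After
all pieces the conditional probability is below `(eΔ)^(s+1)/n ≤ 1`. No randomness is left by then,
so it is `0` and the algorithm succeeds everywhere (`exists_borel_seeds`).

The choice of seeds is made Borel in `exists_borel_seeds_union`. An `r`-ball meets at most one
`G^{2r}`-component of the piece, so different components do not interact. A countable family of
Borel colorings realizes every pattern on a finite component (`exists_dense_colorings`), and each
component uses the first member that works for it. All definability reduces to one fact: projections
of Borel sets with sections of bounded finite size are Borel (`measurableSet_proj_of_ncard_le`). -/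

open MeasureTheory Set

noncomputable section

namespace BorelLocal

/-! ### The Lovász local lemma -/

/-- If removing one further event from the complement of the previous ones costs at most a factor
`1 - x`, then removing the events of `S₁` costs at most a factor `(1 - x) ^ #S₁`. -/
theorem pow_card_mul_le_real_inter {Ω ι : Type*} [MeasurableSpace Ω] [DecidableEq ι]
    {μ : Measure Ω} [IsProbabilityMeasure μ] {A : ι → Set Ω} (hA : ∀ i, MeasurableSet (A i))
    {x : ℝ} (hx1 : x < 1) (S₂ S₁ : Finset ι)
    (h : ∀ T ⊂ S₁, ∀ i ∈ S₁, i ∉ T →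
      μ.real (A i ∩ ⋂ j ∈ T ∪ S₂, (A j)ᶜ) ≤ x * μ.real (⋂ j ∈ T ∪ S₂, (A j)ᶜ)) :
    (1 - x) ^ S₁.card * μ.real (⋂ j ∈ S₂, (A j)ᶜ) ≤ μ.real (⋂ j ∈ S₁ ∪ S₂, (A j)ᶜ) := by
  induction S₁ using Finset.induction_on with
  | empty => simp
  | insert a S ha ih =>
    have ih' := ih fun T hT i hi hiT =>
      h T (hT.trans (Finset.ssubset_insert ha)) i (Finset.mem_insert_of_mem hi) hiT
    have h1 := h S (Finset.ssubset_insert ha) a (Finset.mem_insert_self a S) ha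
    have hdiff : μ.real (⋂ j ∈ insert a S ∪ S₂, (A j)ᶜ) + μ.real (A a ∩ ⋂ j ∈ S ∪ S₂, (A j)ᶜ)
        = μ.real (⋂ j ∈ S ∪ S₂, (A j)ᶜ) := by
      rw [← measureReal_sdiff_add_inter (s := ⋂ j ∈ S ∪ S₂, (A j)ᶜ) (hA a)]
      congr 2
      · rw [Finset.insert_union, Finset.set_biInter_insert]
        ext; simp [and_comm]
      · rw [inter_comm]
    rw [Finset.card_insert_of_notMem ha, pow_succ]
    nlinarith

/-- The Lovász local lemma for finitely many events, where `Γ i` is the neighbourhood of `i` and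
all weights are equal to `x`. -/
theorem lovasz_local_lemma {Ω ι : Type*} [MeasurableSpace Ω] [DecidableEq ι]
    {μ : Measure Ω} [IsProbabilityMeasure μ] {A : ι → Set Ω} (hA : ∀ i, MeasurableSet (A i))
    (Γ : ι → Set ι) {x : ℝ} (hx0 : 0 ≤ x) (hx1 : x < 1) {D : ℕ}
    (hΓ : ∀ (i : ι) (S : Finset ι), i ∉ S → ↑S ⊆ Γ i → S.card ≤ D)
    (hind : ∀ (i : ι) (S : Finset ι), (∀ j ∈ S, j ∉ Γ i) →
      μ.real (A i ∩ ⋂ j ∈ S, (A j)ᶜ) = μ.real (A i) * μ.real (⋂ j ∈ S, (A j)ᶜ))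
    (hp : ∀ i, μ.real (A i) ≤ x * (1 - x) ^ D) (S : Finset ι) :
    (⋂ j ∈ S, (A j)ᶜ).Nonempty := by
  classical
  -- The usual bound `x` on the conditional probability of `A i`, multiplied out so that no
  -- positivity of the conditioning event is needed during the induction.
  have key : ∀ (S : Finset ι) (i : ι), i ∉ S →
      μ.real (A i ∩ ⋂ j ∈ S, (A j)ᶜ) ≤ x * μ.real (⋂ j ∈ S, (A j)ᶜ) := by
    intro S
    induction S using Finset.strongInduction with
    | H S ih =>
      intro i hi
      set S₁ := S.filter (· ∈ Γ i)
      set S₂ := S.filter (· ∉ Γ i)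
      have hS : S₁ ∪ S₂ = S := Finset.filter_union_filter_not_eq _ _
      have hdisj : Disjoint S₁ S₂ := Finset.disjoint_filter_filter_not _ _ _
      have h1 : μ.real (A i ∩ ⋂ j ∈ S, (A j)ᶜ) ≤ μ.real (A i) * μ.real (⋂ j ∈ S₂, (A j)ᶜ) := by
        rw [← hind i S₂ fun j hj => (Finset.mem_filter.1 hj).2]
        refine measureReal_mono (inter_subset_inter_right _ ?_)
        exact biInter_mono (fun j hj => (Finset.mem_filter.1 hj).1) fun _ _ => Subset.rfl
      have h2 : (1 - x) ^ S₁.card * μ.real (⋂ j ∈ S₂, (A j)ᶜ) ≤ μ.real (⋂ j ∈ S, (A j)ᶜ) := by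
        conv_rhs => rw [← hS]
        refine pow_card_mul_le_real_inter hA hx1 S₂ S₁ fun T hT a ha haT => ih _ ?_ _ ?_
        · refine Finset.ssubset_iff_of_subset ?_ |>.2 ⟨a, ?_, ?_⟩
          · rw [← hS]; exact Finset.union_subset_union_left hT.1
          · rw [← hS]; exact Finset.mem_union_left _ ha
          · simpa [haT] using Finset.disjoint_left.1 hdisj ha
        · simpa [haT] using Finset.disjoint_left.1 hdisj ha
      have h3 : (1 - x) ^ D ≤ (1 - x) ^ S₁.card := by
        refine pow_le_pow_of_le_one (by linarith) (by linarith) (hΓ i S₁ ?_ ?_)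
        · exact fun h => hi (Finset.mem_filter.1 h).1
        · exact fun j hj => (Finset.mem_filter.1 hj).2
      calc _ ≤ μ.real (A i) * μ.real (⋂ j ∈ S₂, (A j)ᶜ) := h1
        _ ≤ x * (1 - x) ^ S₁.card * μ.real (⋂ j ∈ S₂, (A j)ᶜ) := by
            refine mul_le_mul_of_nonneg_right ((hp i).trans ?_) measureReal_nonneg
            exact mul_le_mul_of_nonneg_left h3 hx0
        _ ≤ _ := by rw [mul_assoc]; exact mul_le_mul_of_nonneg_left h2 hx0
  have hpos : 0 < μ.real (⋂ j ∈ S, (A j)ᶜ) := by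
    have := pow_card_mul_le_real_inter hA hx1 (μ := μ) ∅ S fun T _ i _ hi => key _ i (by simpa using hi)
    simp only [Finset.notMem_empty, iInter_of_empty, iInter_univ, probReal_univ, mul_one,
      Finset.union_empty] at this
    exact (pow_pos (by linarith) _).trans_le this
  by_contra hne
  rw [not_nonempty_iff_eq_empty] at hne
  simp [hne] at hpos

/-- `1 / e ≤ (1 - 1 / (D + 1)) ^ D`. -/
theorem inv_exp_one_le_one_sub_pow (D : ℕ) :
    1 / Real.exp 1 ≤ (1 - 1 / ((D : ℝ) + 1)) ^ D := by
  rcases Nat.eq_zero_or_pos D with rfl | hD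
  · simpa using inv_le_one_of_one_le₀ (Real.one_le_exp zero_le_one)
  have hD' : (0 : ℝ) < D := by exact_mod_cast hD
  have h1 : 1 - 1 / ((D : ℝ) + 1) = (1 / (D : ℝ) + 1)⁻¹ := by field_simp; ring
  have h2 : (1 / (D : ℝ) + 1) ^ D ≤ Real.exp 1 := by
    calc (1 / (D : ℝ) + 1) ^ D ≤ Real.exp (1 / D) ^ D :=
          pow_le_pow_left₀ (by positivity) (Real.add_one_le_exp _) _
      _ = Real.exp 1 := by rw [← Real.exp_nat_mul]; congr 1; field_simp
  rw [h1, inv_pow, one_div]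
  exact inv_anti₀ (by positivity) h2

/-- The symmetric Lovász local lemma: events of probability at most `1 / (e (D + 1))`, each with at
most `D` other neighbours, can be avoided simultaneously. -/
theorem symmetric_lovasz_local_lemma {Ω ι : Type*} [MeasurableSpace Ω] [DecidableEq ι]
    {μ : Measure Ω} [IsProbabilityMeasure μ] {A : ι → Set Ω} (hA : ∀ i, MeasurableSet (A i))
    (Γ : ι → Set ι) {D : ℕ}
    (hΓ : ∀ (i : ι) (S : Finset ι), i ∉ S → ↑S ⊆ Γ i → S.card ≤ D)
    (hind : ∀ (i : ι) (S : Finset ι), (∀ j ∈ S, j ∉ Γ i) →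
      μ.real (A i ∩ ⋂ j ∈ S, (A j)ᶜ) = μ.real (A i) * μ.real (⋂ j ∈ S, (A j)ᶜ))
    (hp : ∀ i, μ.real (A i) ≤ 1 / (Real.exp 1 * (D + 1))) (S : Finset ι) :
    (⋂ j ∈ S, (A j)ᶜ).Nonempty := by
  -- The weight `1 / (D + 1)` would equal `1` for `D = 0`, which the weighted version excludes; `1 /
  -- e` serves there.
  rcases Nat.eq_zero_or_pos D with rfl | hD
  · refine lovasz_local_lemma hA Γ (x := 1 / Real.exp 1) (by positivity) ?_ hΓ hind ?_ S
    · rw [div_lt_one (Real.exp_pos 1)]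
      simp
    · simpa using hp
  · have hD' : (0 : ℝ) < D := by exact_mod_cast hD
    refine lovasz_local_lemma hA Γ (x := 1 / ((D : ℝ) + 1)) (by positivity) ?_ hΓ hind ?_ S
    · rw [div_lt_one (by positivity)]; linarith
    · intro i
      refine (hp i).trans ?_
      rw [← one_div_mul_one_div, mul_comm]
      exact mul_le_mul_of_nonneg_left (inv_exp_one_le_one_sub_pow D) (by positivity)

/-! ### Uniformly random colorings -/

/-- Color by `a` on `U` and by `b` off `U`. -/
def mix {V C : Type*} (U : Set V) (a b : V → C) (x : V) : C :=
  open Classical in if x ∈ U then a x else b x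

theorem mix_of_mem {V C : Type*} {U : Set V} (a b : V → C) {x : V} (h : x ∈ U) :
    mix U a b x = a x := if_pos h

theorem mix_of_notMem {V C : Type*} {U : Set V} (a b : V → C) {x : V} (h : x ∉ U) :
    mix U a b x = b x := if_neg h

theorem measurable_mix {V C : Type*} [MeasurableSpace C] (U : Set V) :
    Measurable fun p : (V → C) × (V → C) => mix U p.1 p.2 := by
  refine measurable_pi_lambda _ fun x => ?_
  by_cases h : x ∈ U <;> simp only [mix, h, if_true, if_false] <;> fun_prop

/-- The distribution of a uniformly random coloring `V → {0, …, ℓ - 1}`. -/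
def unif (ℓ : ℕ) [NeZero ℓ] (V : Type*) : Measure (V → Fin ℓ) :=
  Measure.infinitePi fun _ => (PMF.uniformOfFintype (Fin ℓ)).toMeasure

instance (ℓ : ℕ) [NeZero ℓ] (V : Type*) : IsProbabilityMeasure (unif ℓ V) := by
  unfold unif; infer_instance

section Uniform

variable {ℓ : ℕ} [NeZero ℓ]

/-- Coordinates are independent, so splicing two independent samples along `U` gives a uniform
sample again. Independence and conditioning on the seeds of `U` are both derived from this by
Fubini, without conditional expectations. -/
theorem map_mix_unif {V : Type*} (U : Set V) :
    ((unif ℓ V).prod (unif ℓ V)).map (fun p => mix U p.1 p.2) = unif ℓ V := by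
  classical
  refine Measure.eq_infinitePi _ fun s t ht => ?_
  have hpre : (fun p : (V → Fin ℓ) × (V → Fin ℓ) => mix U p.1 p.2) ⁻¹' (s : Set V).pi t =
      ((s.filter (· ∈ U) : Finset V) : Set V).pi t ×ˢ
        ((s.filter (· ∉ U) : Finset V) : Set V).pi t := by
    ext p
    simp only [mem_preimage, Set.mem_pi, mem_prod, Finset.coe_filter, mem_ofPred_eq, Finset.mem_coe]
    constructor
    · refine fun h => ⟨fun x hx => ?_, fun x hx => ?_⟩
      · simpa [mix_of_mem _ _ hx.2] using h x hx.1
      · simpa [mix_of_notMem _ _ hx.2] using h x hx.1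
    · rintro ⟨h1, h2⟩ x hx
      by_cases hU : x ∈ U
      · simpa [mix_of_mem _ _ hU] using h1 x ⟨hx, hU⟩
      · simpa [mix_of_notMem _ _ hU] using h2 x ⟨hx, hU⟩
  rw [Measure.map_apply (measurable_mix U) (MeasurableSet.pi s.countable_toSet fun i _ => ht i),
    hpre, Measure.prod_prod, unif, Measure.infinitePi_pi _ fun i _ => ht i,
    Measure.infinitePi_pi _ fun i _ => ht i, Finset.prod_filter_mul_prod_filter_not]

theorem map_comp_unif {V W : Type*} {j : W → V} (hj : Function.Injective j) :
    (unif ℓ V).map (fun θ => θ ∘ j) = unif ℓ W := by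
  classical
  refine Measure.eq_infinitePi _ fun s t ht => ?_
  rcases isEmpty_or_nonempty W with hW | hW
  · have : s = ∅ := Finset.eq_empty_of_isEmpty s
    subst this
    rw [Measure.map_apply (by fun_prop) (by simp)]
    simp
  have hpre : (fun θ : V → Fin ℓ => θ ∘ j) ⁻¹' (s : Set W).pi t =
      ((s.image j : Finset V) : Set V).pi fun v => t (Function.invFun j v) := by
    ext θ
    simp [Set.mem_pi, Function.leftInverse_invFun hj _]
  rw [Measure.map_apply (by fun_prop) (MeasurableSet.pi s.countable_toSet fun i _ => ht i),
    hpre, unif, Measure.infinitePi_pi _ fun i _ => ht _, Finset.prod_image fun a _ b _ h => hj h]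
  simp [Function.leftInverse_invFun hj _]

theorem unif_apply_of_finite {V : Type*} [Finite V] (S : Set (V → Fin ℓ)) :
    (unif ℓ V).real S = (Nat.card S : ℝ) / Nat.card (V → Fin ℓ) := by
  classical
  have := Fintype.ofFinite V
  have hsing : ∀ g : V → Fin ℓ, (unif ℓ V).real {g} = 1 / Nat.card (V → Fin ℓ) := by
    intro g
    have : (0 : ℝ) < ℓ := by exact_mod_cast Nat.pos_of_ne_zero (NeZero.ne ℓ)
    simp [Measure.real, unif]
  have hS : S.Finite := S.toFinite
  have h1 : (unif ℓ V).real S = ∑ g ∈ hS.toFinset, (unif ℓ V).real {g} := by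
    rw [sum_measureReal_singleton, hS.coe_toFinset]
  rw [h1, Finset.sum_congr rfl fun g _ => hsing g, Finset.sum_const, nsmul_eq_mul,
    Nat.card_coe_set_eq, ncard_eq_toFinset_card S hS]
  ring

/-- A set of colorings that is determined by finitely many coordinates is measurable. -/
theorem measurableSet_of_dependsOn {V : Type*} {ℓ : ℕ} {F : Set V} (hF : F.Finite)
    {S : Set (V → Fin ℓ)}
    (hS : ∀ a b : V → Fin ℓ, (∀ x ∈ F, a x = b x) → a ∈ S → b ∈ S) : MeasurableSet S := by
  have := hF.to_subtype
  have heq : S = F.domRestrict ⁻¹' (F.domRestrict '' S) := by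
    refine Subset.antisymm (subset_preimage_image _ _) ?_
    rintro b ⟨a, ha, hab⟩
    exact hS a b (fun x hx => congrFun hab ⟨x, hx⟩) ha
  rw [heq]
  exact (Set.toFinite _).measurableSet.preimage (measurable_pi_lambda _ fun x => measurable_pi_apply _)

/-- Transfer of probabilities between events on different vertex sets that are determined in the
same way by corresponding finite sets of coordinates. -/
theorem unif_eq_of_correspond {V W F : Type*} [Finite F] {i : F → V} {j : F → W}
    (hi : Function.Injective i) (hj : Function.Injective j) {S : Set (V → Fin ℓ)}
    {T : Set (W → Fin ℓ)} (h : ∀ a b, a ∘ i = b ∘ j → (a ∈ S ↔ b ∈ T)) :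
    unif ℓ V S = unif ℓ W T := by
  have hS : S = (fun a => a ∘ i) ⁻¹' {g | ∃ a ∈ S, a ∘ i = g} := by
    refine Subset.antisymm (fun a ha => ⟨a, ha, rfl⟩) ?_
    rintro a ⟨a', ha', haa⟩
    obtain ⟨b, hb⟩ := hj.surjective_comp_right (γ := Fin ℓ) (a ∘ i)
    exact (h a b hb.symm).2 ((h a' b (haa.trans hb.symm)).1 ha')
  have hT : T = (fun b => b ∘ j) ⁻¹' {g | ∃ a ∈ S, a ∘ i = g} := by
    ext b
    constructor
    · intro hb
      obtain ⟨a, ha⟩ := hi.surjective_comp_right (γ := Fin ℓ) (b ∘ j)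
      exact ⟨a, (h a b ha).2 hb, ha⟩
    · rintro ⟨a, ha, hab⟩
      exact (h a b hab).1 ha
  have hm : MeasurableSet {g : F → Fin ℓ | ∃ a ∈ S, a ∘ i = g} := (Set.toFinite _).measurableSet
  rw [hS, hT, ← Measure.map_apply (by fun_prop) hm, ← Measure.map_apply (by fun_prop) hm,
    map_comp_unif hi, map_comp_unif hj]

/-- Events determined by complementary sets of coordinates are independent. -/
theorem unif_inter_of_complementary {V : Type*} (U : Set V) {A B : Set (V → Fin ℓ)}
    (hA : MeasurableSet A) (hB : MeasurableSet B)
    (hAU : ∀ a b : V → Fin ℓ, (∀ x ∈ U, a x = b x) → a ∈ A → b ∈ A)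
    (hBU : ∀ a b : V → Fin ℓ, (∀ x ∉ U, a x = b x) → a ∈ B → b ∈ B) :
    (unif ℓ V).real (A ∩ B) = (unif ℓ V).real A * (unif ℓ V).real B := by
  rw [← measureReal_prod_prod]
  conv_lhs => rw [← map_mix_unif U, map_measureReal_apply (measurable_mix U) (hA.inter hB)]
  congr 1
  ext ⟨a, b⟩
  have h1 : mix U a b ∈ A ↔ a ∈ A :=
    ⟨hAU _ _ fun x hx => mix_of_mem _ _ hx, hAU _ _ fun x hx => (mix_of_mem _ _ hx).symm⟩
  have h2 : mix U a b ∈ B ↔ b ∈ B :=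
    ⟨hBU _ _ fun x hx => mix_of_notMem _ _ hx, hBU _ _ fun x hx => (mix_of_notMem _ _ hx).symm⟩
  simp [h1, h2]

/-- Markov's inequality for the conditional probability of `B` given the coloring of `U`. -/
theorem unif_conditional_ge_le {V : Type*} (U : Set V) {B : Set (V → Fin ℓ)}
    (hB : MeasurableSet B) {p q : ℝ} (hq : 0 < q) (hp : (unif ℓ V).real B ≤ p) :
    (unif ℓ V).real {a | q ≤ (unif ℓ V).real {b | mix U a b ∈ B}} ≤ p / q := by
  have hm : MeasurableSet ((fun p : (V → Fin ℓ) × (V → Fin ℓ) => mix U p.1 p.2) ⁻¹' B) :=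
    measurable_mix U hB
  have h1 : ∫⁻ a, unif ℓ V {b | mix U a b ∈ B} ∂(unif ℓ V) = unif ℓ V B := by
    conv_rhs => rw [← map_mix_unif U, Measure.map_apply (measurable_mix U) hB,
      Measure.prod_apply hm]
    rfl
  have h2 := mul_meas_ge_le_lintegral₀ (μ := unif ℓ V)
    (f := fun a => unif ℓ V {b | mix U a b ∈ B})
    (measurable_measure_prodMk_left hm).aemeasurable (ENNReal.ofReal q)
  rw [h1] at h2
  have hset : {a | q ≤ (unif ℓ V).real {b | mix U a b ∈ B}} =
      {a | ENNReal.ofReal q ≤ unif ℓ V {b | mix U a b ∈ B}} := by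
    ext a
    exact (ENNReal.ofReal_le_iff_le_toReal (measure_ne_top _ _)).symm
  rw [le_div_iff₀ hq, mul_comm, hset]
  refine le_trans ?_ hp
  have h3 := ENNReal.toReal_mono (measure_ne_top _ _) h2
  rwa [ENNReal.toReal_mul, ENNReal.toReal_ofReal hq.le] at h3

end Uniform

/-! ### Projections of Borel sets with finite sections -/

/-- The projection of a Borel set whose sections have bounded finite size is Borel. -/
theorem measurableSet_proj_of_ncard_le {X Y : Type*} [MeasurableSpace X] [MeasurableSpace Y]
    [StandardBorelSpace X] [StandardBorelSpace Y] (K : ℕ) {E : Set (X × Y)} (hE : MeasurableSet E)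
    (hfin : ∀ x, {y | (x, y) ∈ E}.Finite) (hcard : ∀ x, {y | (x, y) ∈ E}.ncard ≤ K) :
    MeasurableSet {x | ∃ y, (x, y) ∈ E} := by
  classical
  induction K generalizing E with
  | zero =>
    convert! MeasurableSet.empty
    ext x
    have := (ncard_eq_zero (hfin x)).1 (Nat.le_zero.1 (hcard x))
    simpa [Set.eq_empty_iff_forall_notMem] using this
  | succ K ih =>
    have he := measurableEmbedding_embeddingReal Y
    -- Increasing enumerations of `K + 1` points of a section, ordered through a Borel embedding
    -- into `ℝ`. A section of maximal size has exactly one and smaller ones have none, so the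
    -- projection of `E'` is injective and its image is Borel by Lusin–Souslin.
    set E' : Set (X × (Fin (K + 1) → Y)) :=
      {p | (∀ i, (p.1, p.2 i) ∈ E) ∧
        ∀ i j, i < j → embeddingReal Y (p.2 i) < embeddingReal Y (p.2 j)} with hE'
    have hE'm : MeasurableSet E' := by
      refine measurableSet_setOfPred.2 (.and (.forall fun i => ?_)
        (.forall fun i => .forall fun j => .forall fun _ => ?_))
      · exact measurableSet_setOfPred.1 (hE.preimage
          (f := fun p : X × (Fin (K + 1) → Y) => (p.1, p.2 i)) (by fun_prop))
      · exact measurableSet_setOfPred.1 (measurableSet_lt (he.measurable.comp (by fun_prop))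
          (he.measurable.comp (by fun_prop)))
    have hinj : InjOn Prod.fst E' := by
      rintro ⟨x, t⟩ ⟨ht, hmono⟩ ⟨x', t'⟩ ⟨ht', hmono'⟩ hxx
      obtain rfl : x = x' := hxx
      set s : Finset ℝ := (hfin x).toFinset.image (embeddingReal Y)
      have hts : ∀ i, embeddingReal Y (t i) ∈ s := fun i =>
        Finset.mem_image_of_mem _ ((hfin x).mem_toFinset.2 (ht i))
      have hts' : ∀ i, embeddingReal Y (t' i) ∈ s := fun i =>
        Finset.mem_image_of_mem _ ((hfin x).mem_toFinset.2 (ht' i))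
      have hm : StrictMono fun i => embeddingReal Y (t i) := fun i j => hmono i j
      have hm' : StrictMono fun i => embeddingReal Y (t' i) := fun i j => hmono' i j
      have hs : s.card = K + 1 := by
        refine le_antisymm (Finset.card_image_le.trans ?_) ?_
        · rw [← ncard_eq_toFinset_card _ (hfin x)]; exact hcard x
        · simpa using Finset.card_le_card_of_injOn (s := Finset.univ) _
            (fun i _ => hts i) hm.injective.injOn
      have := (Finset.orderEmbOfFin_unique hs hts hm).trans
        (Finset.orderEmbOfFin_unique hs hts' hm').symm
      exact Prod.ext rfl (funext fun i => he.injective (congrFun this i))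
    have hX : MeasurableSet (Prod.fst '' E') := hE'm.image_of_measurable_injOn measurable_fst hinj
    have hfull : ∀ x, {y | (x, y) ∈ E}.ncard = K + 1 → x ∈ Prod.fst '' E' := by
      intro x hx
      set s : Finset ℝ := (hfin x).toFinset.image (embeddingReal Y)
      have hs : s.card = K + 1 := by
        rw [Finset.card_image_of_injective _ he.injective, ← ncard_eq_toFinset_card _ (hfin x), hx]
      have hmem := fun i => s.orderEmbOfFin_mem hs i
      simp only [s, Finset.mem_image, Finite.mem_toFinset] at hmem
      choose t ht hte using hmem
      exact ⟨(x, t), ⟨ht, fun i j hij => by rw [hte, hte]; exact (s.orderEmbOfFin hs).strictMono hij⟩,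
        rfl⟩
    -- Deleting the sections of size `K + 1` leaves sections of size at most `K`.
    have hrest := ih (E := E \ (Prod.fst '' E') ×ˢ univ) (hE.diff (hX.prod .univ))
      (fun x => (hfin x).subset fun y hy => hy.1) (fun x => ?_)
    · convert hX.union hrest using 1
      ext x
      constructor
      · rintro ⟨y, hy⟩
        by_cases hx : x ∈ Prod.fst '' E'
        · exact Or.inl hx
        · exact Or.inr ⟨y, hy, fun h => hx h.1⟩
      · rintro (⟨⟨x', t⟩, ht, rfl⟩ | ⟨y, hy⟩)
        · exact ⟨t 0, ht.1 0⟩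
        · exact ⟨y, hy.1⟩
    · by_cases hx : x ∈ Prod.fst '' E'
      · have : {y | (x, y) ∈ E \ (Prod.fst '' E') ×ˢ univ} = ∅ := by
          refine eq_empty_of_forall_notMem fun y hy => hy.2 ⟨hx, trivial⟩
        rw [this, ncard_empty]
        exact Nat.zero_le K
      · have h1 : {y | (x, y) ∈ E \ (Prod.fst '' E') ×ˢ univ}.ncard ≤ {y | (x, y) ∈ E}.ncard :=
          ncard_le_ncard (fun y hy => hy.1) (hfin x)
        have h2 := hcard x
        have h3 : {y | (x, y) ∈ E}.ncard ≠ K + 1 := fun h => hx (hfull x h)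
        omega

/-- There is a countable family of Borel colorings that realizes every pattern on every finite
set. -/
theorem exists_dense_colorings (V : Type*) [MeasurableSpace V] [StandardBorelSpace V] (ℓ : ℕ)
    [NeZero ℓ] :
    ∃ f : ℕ → V → Fin ℓ, (∀ k, Measurable (f k)) ∧
      ∀ C : Set V, C.Finite → ∀ h : V → Fin ℓ, ∃ k, ∀ x ∈ C, f k x = h x := by
  let bits (N : ℕ) (v : V) (i : Fin N) : Bool := MeasurableSpace.mapNatBool V v i
  have hbits : ∀ N, Measurable (bits N) := fun N =>
    measurable_pi_lambda _ fun i =>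
      (measurable_pi_apply (i : ℕ)).comp (MeasurableSpace.measurable_mapNatBool V)
  -- Colorings that read only finitely many bits of a point: there are countably many, and finitely
  -- many bits separate the points of a finite set.
  let I := Σ N : ℕ, ((Fin N → Bool) → Fin ℓ)
  obtain ⟨enum, henum⟩ := exists_surjective_nat I
  refine ⟨fun k v => (enum k).2 (bits _ v), fun k => ?_, fun C hC h => ?_⟩
  · exact (measurable_of_finite _).comp (hbits _)
  have hsep : ∃ N, InjOn (bits N) C := by
    have hex : ∀ p : V × V, ∃ n : ℕ, p.1 ≠ p.2 →
        MeasurableSpace.mapNatBool V p.1 n ≠ MeasurableSpace.mapNatBool V p.2 n := by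
      intro p
      by_cases hp : p.1 = p.2
      · exact ⟨0, fun h => (h hp).elim⟩
      · obtain ⟨n, hn⟩ := Function.ne_iff.1 ((MeasurableSpace.injective_mapNatBool V).ne hp)
        exact ⟨n, fun _ => hn⟩
    choose b hb using hex
    obtain ⟨M, hM⟩ := ((hC.prod hC).image b).bddAbove
    refine ⟨M + 1, fun x hx y hy hxy => ?_⟩
    by_contra hne
    refine hb (x, y) hne ?_
    exact congrFun hxy ⟨b (x, y), Nat.lt_succ_of_le (hM ⟨(x, y), ⟨hx, hy⟩, rfl⟩)⟩
  obtain ⟨N, hN⟩ := hsep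
  obtain ⟨k, hk⟩ := henum ⟨N, fun c => open Classical in
    if hc : ∃ x ∈ C, bits N x = c then h hc.choose else 0⟩
  refine ⟨k, fun x hx => ?_⟩
  have hc : ∃ x' ∈ C, bits N x' = bits N x := ⟨x, hx, rfl⟩
  have hval : ∀ i : I, i = enum k → i.2 (bits _ x) = (enum k).2 (bits _ x) := fun _ h => h ▸ rfl
  refine (hval _ hk.symm).symm.trans ?_
  exact (dif_pos hc).trans (congrArg h (hN hc.choose_spec.1 hx hc.choose_spec.2))

/-! ### Balls -/

section Ball

variable {V : Type u} {G : SimpleGraph V}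

theorem ball_mono {a b : ℕ} (h : a ≤ b) (x : V) : ball G x a ⊆ ball G x b :=
  fun _ ⟨p, hp⟩ => ⟨p, hp.trans h⟩

theorem mem_ball_comm {x y : V} {a : ℕ} : y ∈ ball G x a ↔ x ∈ ball G y a :=
  ⟨fun ⟨p, hp⟩ => ⟨p.reverse, by simpa using hp⟩, fun ⟨p, hp⟩ => ⟨p.reverse, by simpa using hp⟩⟩

theorem mem_ball_add {x y z : V} {a b : ℕ} (hy : y ∈ ball G x a) (hz : z ∈ ball G y b) :
    z ∈ ball G x (a + b) := by
  obtain ⟨p, hp⟩ := hy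
  obtain ⟨q, hq⟩ := hz
  exact ⟨p.append q, by rw [SimpleGraph.Walk.length_append]; omega⟩

theorem mem_ball_zero {x y : V} : y ∈ ball G x 0 ↔ y = x := by
  constructor
  · rintro ⟨p, hp⟩
    exact (SimpleGraph.Walk.eq_of_length_eq_zero (Nat.le_zero.1 hp)).symm
  · rintro rfl
    exact mem_ball_self _ _ _

theorem mem_ball_succ {x y : V} {a : ℕ} :
    y ∈ ball G x (a + 1) ↔ y ∈ ball G x a ∨ ∃ w ∈ ball G x a, G.Adj w y := by
  constructor
  · rw [mem_ball_comm]
    rintro ⟨p, hp⟩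
    cases p with
    | nil => exact Or.inl (mem_ball_self _ _ _)
    | cons h q =>
      rw [SimpleGraph.Walk.length_cons] at hp
      exact Or.inr ⟨_, mem_ball_comm.1 ⟨q, by omega⟩, h.symm⟩
  · rintro (h | ⟨w, hw, hadj⟩)
    · exact ball_mono (Nat.le_succ a) _ h
    · exact mem_ball_add hw ⟨hadj.toWalk, by simp⟩

end Ball

/-- The last intermediate vertex of a path ranges over a ball of bounded size, so quantifying over
it preserves Borelness. -/
theorem measurableSet_mem_ball {V : Type u} [MeasurableSpace V] [StandardBorelSpace V]
    {G : SimpleGraph V} (hG : MeasurableSet {p : V × V | G.Adj p.1 p.2}) {N K : ℕ}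
    (hfin : ∀ v, (ball G v N).Finite) (hcard : ∀ v, (ball G v N).ncard ≤ K) {r : ℕ} (hr : r ≤ N) :
    MeasurableSet {p : V × V | p.2 ∈ ball G p.1 r} := by
  induction r with
  | zero =>
    simp only [mem_ball_zero]
    exact measurableSet_eq_fun measurable_snd measurable_fst
  | succ r ih =>
    have ih := ih (by omega)
    simp only [mem_ball_succ]
    refine MeasurableSet.union ih ?_
    have hsub : ∀ p : V × V, {w | w ∈ ball G p.1 r ∧ G.Adj w p.2} ⊆ ball G p.1 N :=
      fun p w hw => ball_mono (by omega) _ hw.1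
    refine measurableSet_proj_of_ncard_le K
      (E := {q : (V × V) × V | q.2 ∈ ball G q.1.1 r ∧ G.Adj q.2 q.1.2}) ?_
      (fun p => (hfin p.1).subset (hsub p))
      fun p => (ncard_le_ncard (hsub p) (hfin p.1)).trans (hcard p.1)
    exact (ih.preimage (f := fun q : (V × V) × V => (q.1.1, q.2)) (by fun_prop)).inter
      (hG.preimage (f := fun q : (V × V) × V => (q.2, q.1.2)) (by fun_prop))

/-! ### Borel sets of vertices defined by the isomorphism type of a ball -/

theorem ncard_setOf_forall_mem {V : Type*} {S : Set V} (hS : S.Finite) (m : ℕ) :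
    {t : Fin m → V | ∀ i, t i ∈ S}.Finite ∧ {t : Fin m → V | ∀ i, t i ∈ S}.ncard = S.ncard ^ m := by
  classical
  have : {t : Fin m → V | ∀ i, t i ∈ S} = (Fintype.piFinset fun _ : Fin m => hS.toFinset) := by
    ext t; simp
  rw [this]
  refine ⟨Finset.finite_toSet _, ?_⟩
  rw [ncard_coe_finset, Fintype.card_piFinset_const, ncard_eq_toFinset_card S hS]

/-- Codes for rooted labeled structured graphs on `Fin m` whose structure map is defined on tuples
of length at most `L`. -/
abbrev Pattern (m L : ℕ) : Type :=
  (Fin m → Fin m → Prop) × (Fin m → ℕ) × ((Σ k : Fin (L + 1), (Fin k → Fin m)) → Option ℕ) × Fin m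

/-- The tuple `t` enumerates the `r`-ball around `v`, and the induced rooted labeled structured
graph on this ball has the code `p`. -/
structure Realizes {V : Type u} (G : StructuredGraph V) (f : V → ℕ) (r : ℕ) {m L : ℕ}
    (p : Pattern m L) (v : V) (t : Fin m → V) : Prop where
  mem : ∀ i, t i ∈ ball G.graph v r
  -- A negated existential over a ball, hence the complement of a projection with small sections.
  cover : ¬ ∃ u, u ∈ ball G.graph v r ∧ ∀ i, u ≠ t i
  inj : ∀ i j, t i = t j → i = j
  root : t p.2.2.2 = v
  adj : ∀ i j, G.graph.Adj (t i) (t j) ↔ p.1 i j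
  label : ∀ i, f (t i) = p.2.1 i
  str : ∀ k : Σ k : Fin (L + 1), (Fin k → Fin m), G.σ ⟨k.1, t ∘ k.2⟩ = p.2.2.1 k

section Realizes

variable {V : Type u} {G : StructuredGraph V} {f : V → ℕ} {r m L : ℕ}

/-- The enumeration of the ball as a bijection. -/
def Realizes.equiv {p : Pattern m L} {v : V} {t : Fin m → V} (h : Realizes G f r p v t) :
    Fin m ≃ ball G.graph v r :=
  Equiv.ofBijective (fun i => ⟨t i, h.mem i⟩)
    ⟨fun i j hij => h.inj i j (congrArg Subtype.val hij), fun u => by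
      by_contra hu
      exact h.cover ⟨u, u.2, fun i hi => hu ⟨i, Subtype.ext hi.symm⟩⟩⟩

/-- Two balls with the same code are isomorphic. -/
theorem Realizes.exists_iso (hL : ∀ x : Tuple V, G.σ x ≠ none → x.1 ≤ L) {p : Pattern m L}
    {v v' : V} {t t' : Fin m → V} (h : Realizes G f r p v t) (h' : Realizes G f r p v' t') :
    ∃ e : StructuredIso (G.induce (ball G.graph v r)) (G.induce (ball G.graph v' r)),
      e.iso ⟨v, mem_ball_self G.graph v r⟩ = ⟨v', mem_ball_self G.graph v' r⟩ ∧
      ∀ x, f (e.iso x) = f x := by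
  have hsurj : ∀ x : ball G.graph v r, ∃ i, h.equiv i = x := h.equiv.surjective
  let E := h.equiv.symm.trans h'.equiv
  have hE : ∀ i, E (h.equiv i) = h'.equiv i := fun i => by simp [E]
  refine ⟨⟨⟨E, ?_⟩, ?_⟩, ?_, ?_⟩
  · intro x y
    obtain ⟨i, rfl⟩ := hsurj x
    obtain ⟨j, rfl⟩ := hsurj y
    rw [hE, hE]
    exact (h'.adj i j).trans (h.adj i j).symm
  · rintro ⟨k, x⟩
    obtain ⟨τ, rfl⟩ : ∃ τ : Fin k → Fin m, x = fun i => h.equiv (τ i) :=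
      ⟨fun i => h.equiv.symm (x i), by simp⟩
    change G.σ ⟨k, fun i => (E (h.equiv (τ i)) : V)⟩ = G.σ ⟨k, fun i => (h.equiv (τ i) : V)⟩
    simp only [hE]
    change G.σ ⟨k, t' ∘ τ⟩ = G.σ ⟨k, t ∘ τ⟩
    by_cases hk : k < L + 1
    · exact (h'.str ⟨⟨k, hk⟩, τ⟩).trans (h.str ⟨⟨k, hk⟩, τ⟩).symm
    · have hnone : ∀ s : Fin k → V, G.σ ⟨k, s⟩ = none := fun s => by
        by_contra hs
        exact hk (Nat.lt_succ_of_le (hL _ hs))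
      rw [hnone, hnone]
  · have h1 : (⟨v, mem_ball_self G.graph v r⟩ : ball G.graph v r) = h.equiv p.2.2.2 :=
      Subtype.ext h.root.symm
    change E _ = _
    rw [h1, hE]
    exact Subtype.ext h'.root
  · intro x
    obtain ⟨i, rfl⟩ := hsurj x
    change f (E (h.equiv i)) = _
    rw [hE]
    exact (h'.label i).trans (h.label i).symm

theorem exists_realizes (G : StructuredGraph V) (f : V → ℕ) (L : ℕ) {v : V}
    (hfin : (ball G.graph v r).Finite) :
    ∃ (p : Pattern (ball G.graph v r).ncard L) (t : _), Realizes G f r p v t := by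
  have := hfin.to_subtype
  let e : Fin (ball G.graph v r).ncard ≃ ball G.graph v r := (Finite.equivFin _).symm
  refine ⟨⟨fun i j => G.graph.Adj (e i) (e j), fun i => f (e i),
    fun k => G.σ ⟨k.1, fun i => e (k.2 i)⟩, e.symm ⟨v, mem_ball_self _ _ _⟩⟩, fun i => e i,
    fun i => (e i).2, ?_, ?_, ?_, fun _ _ => Iff.rfl, fun _ => rfl, fun _ => rfl⟩
  · rintro ⟨u, hu, hne⟩
    exact hne (e.symm ⟨u, hu⟩) (by simp)
  · exact fun i j hij => e.injective (Subtype.ext hij)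
  · simp

variable [MeasurableSpace V] [StandardBorelSpace V]

theorem measurableSet_realizes (hG : G.IsBorel) (hf : Measurable f)
    (hfin : ∀ v, (ball G.graph v r).Finite) {K : ℕ} (hcard : ∀ v, (ball G.graph v r).ncard ≤ K)
    (hr : MeasurableSet {p : V × V | p.2 ∈ ball G.graph p.1 r}) (p : Pattern m L) :
    MeasurableSet {v | ∃ t, Realizes G f r p v t} := by
  have hsub : ∀ v, {t | Realizes G f r p v t} ⊆ {t : Fin m → V | ∀ i, t i ∈ ball G.graph v r} :=
    fun v t ht => ht.mem
  have hpi := fun v => ncard_setOf_forall_mem (hfin v) m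
  refine measurableSet_proj_of_ncard_le (K ^ m)
    (E := {q : V × (Fin m → V) | Realizes G f r p q.1 q.2}) ?_
    (fun v => (hpi v).1.subset (hsub v)) fun v => ?_
  · have hset : {q : V × (Fin m → V) | Realizes G f r p q.1 q.2} = {q |
        (∀ i, q.2 i ∈ ball G.graph q.1 r) ∧ (¬ ∃ u, u ∈ ball G.graph q.1 r ∧ ∀ i, u ≠ q.2 i) ∧
        (∀ i j, q.2 i = q.2 j → i = j) ∧ q.2 p.2.2.2 = q.1 ∧
        (∀ i j, G.graph.Adj (q.2 i) (q.2 j) ↔ p.1 i j) ∧ (∀ i, f (q.2 i) = p.2.1 i) ∧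
        ∀ k : Σ k : Fin (L + 1), (Fin k → Fin m), G.σ ⟨k.1, q.2 ∘ k.2⟩ = p.2.2.1 k} := by
      ext q
      exact ⟨fun ⟨a, b, c, d, e, f, g⟩ => ⟨a, b, c, d, e, f, g⟩,
        fun ⟨a, b, c, d, e, f, g⟩ => ⟨a, b, c, d, e, f, g⟩⟩
    rw [hset]
    refine measurableSet_setOfPred.2 (.and (.forall fun i => ?_) (.and (.not ?_)
      (.and (.forall fun i => .forall fun j => .imp ?_ measurable_const) (.and ?_
      (.and (.forall fun i => .forall fun j => .iff ?_ measurable_const)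
      (.and (.forall fun i => ?_) (.forall fun k => ?_)))))))
    · exact measurableSet_setOfPred.1 (hr.preimage
        (f := fun q : V × (Fin m → V) => (q.1, q.2 i)) (by fun_prop))
    · refine measurableSet_setOfPred.1 (measurableSet_proj_of_ncard_le K
        (E := {q : (V × (Fin m → V)) × V | q.2 ∈ ball G.graph q.1.1 r ∧ ∀ i, q.2 ≠ q.1.2 i}) ?_
        (fun q => (hfin q.1).subset fun u hu => hu.1)
        fun q => (ncard_le_ncard (fun u hu => hu.1) (hfin q.1)).trans (hcard q.1))
      refine measurableSet_setOfPred.2 (.and ?_ (.forall fun i => .not ?_))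
      · exact measurableSet_setOfPred.1 (hr.preimage
          (f := fun q : (V × (Fin m → V)) × V => (q.1.1, q.2)) (by fun_prop))
      · exact measurableSet_setOfPred.1 (measurableSet_eq_fun (by fun_prop) (by fun_prop))
    · exact measurableSet_setOfPred.1 (measurableSet_eq_fun (by fun_prop) (by fun_prop))
    · exact measurableSet_setOfPred.1 (measurableSet_eq_fun (by fun_prop) (by fun_prop))
    · exact measurableSet_setOfPred.1 (hG.adj.preimage
        (f := fun q : V × (Fin m → V) => (q.2 i, q.2 j)) (by fun_prop))
    · exact measurableSet_setOfPred.1 (measurableSet_eq_fun (by fun_prop) (by fun_prop))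
    · have hmk : Measurable fun q : V × (Fin m → V) => (⟨k.1, q.2 ∘ k.2⟩ : Tuple V) := by
        have h1 : Measurable (Sigma.mk (β := fun k : ℕ => Fin k → V) (k.1 : ℕ)) :=
          measurable_iff_le_map.2 (iInf_le _ _)
        exact h1.comp (by fun_prop)
      have hsome : ∀ i, Measurable fun q : V × (Fin m → V) => G.σ ⟨k.1, q.2 ∘ k.2⟩ = some i :=
        fun i => measurableSet_setOfPred.1 ((hG.σ i).preimage hmk)
      rcases p.2.2.1 k with _ | i
      · have : (fun q : V × (Fin m → V) => G.σ ⟨k.1, q.2 ∘ k.2⟩ = none) =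
            fun q => ∀ i, ¬ G.σ ⟨k.1, q.2 ∘ k.2⟩ = some i := by
          ext q; rw [Option.eq_none_iff_forall_ne_some]
        rw [this]
        exact .forall fun i => (hsome i).not
      · exact hsome i
  · exact ((ncard_le_ncard (hsub v) (hpi v).1).trans (hpi v).2.le).trans
      (Nat.pow_le_pow_left (hcard v) m)

/-- A set of vertices that is determined by the isomorphism type of the labeled `r`-ball is
Borel. -/
theorem measurableSet_of_ball_invariant (hG : G.IsBorel) (hf : Measurable f)
    (hfin : ∀ v, (ball G.graph v r).Finite) {K : ℕ} (hcard : ∀ v, (ball G.graph v r).ncard ≤ K)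
    (hr : MeasurableSet {p : V × V | p.2 ∈ ball G.graph p.1 r}) {Q : V → Prop}
    (hQ : ∀ (v v' : V) (e : StructuredIso (G.induce (ball G.graph v r))
      (G.induce (ball G.graph v' r))),
      e.iso ⟨v, mem_ball_self G.graph v r⟩ = ⟨v', mem_ball_self G.graph v' r⟩ →
      (∀ x, f (e.iso x) = f x) → Q v → Q v') :
    MeasurableSet {v | Q v} := by
  obtain ⟨L, hL⟩ := G.bounded
  -- There are only countably many codes, and by invariance `Q` holds at all or none of the vertices
  -- realizing a given code.
  have hset : {v | Q v} = ⋃ (p : Σ m, Pattern m L)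
      (_ : ∃ v t, Realizes G f r p.2 v t ∧ Q v), {v | ∃ t, Realizes G f r p.2 v t} := by
    ext v
    simp only [mem_iUnion]
    constructor
    · intro hv
      obtain ⟨p, t, h⟩ := exists_realizes G f L (hfin v)
      exact ⟨⟨_, p⟩, ⟨v, t, h, hv⟩, t, h⟩
    · rintro ⟨p, ⟨v', t', h', hv'⟩, t, h⟩
      obtain ⟨e, he, hl⟩ := h'.exists_iso hL h
      exact hQ v' v e he hl hv'
  rw [hset]
  exact .iUnion fun p => .iUnion fun _ => measurableSet_realizes hG hf hfin hcard hr p.2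

end Realizes

/-! ### Isomorphisms between balls -/

/-- The inverse of an isomorphism of structured graphs. -/
def StructuredIso.symm {V : Type u} {W : Type v} {G : StructuredGraph V} {H : StructuredGraph W}
    (e : StructuredIso G H) : StructuredIso H G where
  iso := e.iso.symm
  map_σ x := by
    rw [← e.map_σ]
    congr 1
    simp [Tuple.map]

theorem ballClass_eq {V W : Type u} {G : StructuredGraph V} {H : StructuredGraph W} {v : V} {w : W}
    {r : ℕ} (e : StructuredIso (G.induce (ball G.graph v r)) (H.induce (ball H.graph w r)))
    (he : e.iso ⟨v, mem_ball_self G.graph v r⟩ = ⟨w, mem_ball_self H.graph w r⟩) {f : V → ℕ}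
    {g : W → ℕ} (hfg : ∀ x, g (e.iso x) = f x) (h : (ball G.graph v r).Finite)
    (h' : (ball H.graph w r).Finite) : ballClass G f v r h = ballClass H g w r h' :=
  Quotient.sound (show RootedLabeled.Isomorphic _ _ from ⟨e, he, hfg⟩)

section BallIso

variable {V W : Type u} {G : StructuredGraph V} {H : StructuredGraph W} {v : V} {w : W} {r : ℕ}
  (e : StructuredIso (G.induce (ball G.graph v r)) (H.induce (ball H.graph w r)))

/-- Since `a + b ≤ r`, a path of length at most `b` from `y` stays inside the `r`-ball around `v`,
where the isomorphism can transport it edge by edge. -/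
theorem StructuredIso.mem_ball {y : V} {a b : ℕ} (hab : a + b ≤ r) (hya : y ∈ ball G.graph v a)
    (hy : y ∈ ball G.graph v r) {z : V} (hz : z ∈ ball G.graph v r) (hzy : z ∈ ball G.graph y b) :
    (e.iso ⟨z, hz⟩ : W) ∈ ball H.graph (e.iso ⟨y, hy⟩) b := by
  induction b generalizing z with
  | zero =>
    obtain rfl := mem_ball_zero.1 hzy
    exact mem_ball_self _ _ _
  | succ b ih =>
    rcases mem_ball_succ.1 hzy with h | ⟨u, hu, hadj⟩
    · exact ball_mono (Nat.le_succ b) _ (ih (by omega) hz h)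
    · have hur : u ∈ ball G.graph v r := ball_mono (by omega) _ (mem_ball_add hya hu)
      exact mem_ball_succ.2 (Or.inr ⟨_, ih (by omega) hur hu,
        e.iso.map_rel_iff.2 (show (G.induce _).graph.Adj ⟨u, hur⟩ ⟨z, hz⟩ from hadj)⟩)


theorem StructuredIso.mem_ball_root
    (he : e.iso ⟨v, mem_ball_self G.graph v r⟩ = ⟨w, mem_ball_self H.graph w r⟩)
    {y : V} {a : ℕ} (ha : a ≤ r) (hya : y ∈ ball G.graph v a)
    (hy : y ∈ ball G.graph v r) : (e.iso ⟨y, hy⟩ : W) ∈ ball H.graph w a := by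
  have := e.mem_ball (a := 0) (b := a) (by omega) (mem_ball_self _ _ _) (mem_ball_self _ _ _) hy hya
  rwa [he] at this

/-- An isomorphism between balls restricts to smaller balls contained in them. -/
theorem StructuredIso.exists_restrict
    (he : e.iso ⟨v, mem_ball_self G.graph v r⟩ = ⟨w, mem_ball_self H.graph w r⟩)
    {y : V} {a b : ℕ} (hab : a + b ≤ r)
    (hya : y ∈ ball G.graph v a) (hy : y ∈ ball G.graph v r) {y' : W}
    (hy' : (e.iso ⟨y, hy⟩ : W) = y') :
    ∃ e' : StructuredIso (G.induce (ball G.graph y b)) (H.induce (ball H.graph y' b)),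
      ∀ (z : ball G.graph y b) (hz : (z : V) ∈ ball G.graph v r),
        (e'.iso z : W) = e.iso ⟨z, hz⟩ := by
  subst hy'
  have hsub : ∀ z ∈ ball G.graph y b, z ∈ ball G.graph v r := fun z hz =>
    ball_mono hab _ (mem_ball_add hya hz)
  have hya' := e.mem_ball_root he (by omega) hya hy
  have hsub' : ∀ z ∈ ball H.graph (e.iso ⟨y, hy⟩ : W) b, z ∈ ball H.graph w r := fun z hz =>
    ball_mono hab _ (mem_ball_add hya' hz)
  have hback : ∀ (z : W) (hz : z ∈ ball H.graph (e.iso ⟨y, hy⟩ : W) b),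
      (e.iso.symm ⟨z, hsub' z hz⟩ : V) ∈ ball G.graph y b := fun z hz => by
    have := e.symm.mem_ball hab hya' (e.iso ⟨y, hy⟩).2 (hsub' z hz) hz
    have h2 : e.symm.iso ⟨(e.iso ⟨y, hy⟩ : W), (e.iso ⟨y, hy⟩).2⟩ = ⟨y, hy⟩ :=
      e.iso.symm_apply_apply _
    rw [h2] at this
    exact this
  refine ⟨⟨⟨⟨fun z => ⟨e.iso ⟨z, hsub z z.2⟩, e.mem_ball hab hya hy _ z.2⟩,
    fun z => ⟨e.iso.symm ⟨z, hsub' z z.2⟩, hback z z.2⟩, fun z => ?_, fun z => ?_⟩, ?_⟩, ?_⟩, ?_⟩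
  · have := congrArg Subtype.val (e.iso.symm_apply_apply ⟨z, hsub z z.2⟩)
    exact Subtype.ext this
  · have := congrArg Subtype.val (e.iso.apply_symm_apply ⟨z, hsub' z z.2⟩)
    exact Subtype.ext this
  · intro x z
    exact e.iso.map_rel_iff (a := ⟨x, hsub x x.2⟩) (b := ⟨z, hsub z z.2⟩)
  · exact fun x => e.map_σ (x.map fun z : ball G.graph y b => (⟨z, hsub z z.2⟩ : ball G.graph v r))
  · exact fun z hz => rfl

theorem StructuredIso.output_eq
    (he : e.iso ⟨v, mem_ball_self G.graph v r⟩ = ⟨w, mem_ball_self H.graph w r⟩)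
    (A : LocalAlgorithm.{u}) {T : ℕ} {f : V → ℕ} {g : W → ℕ}
    (hfg : ∀ x, g (e.iso x) = f x) {y : V} {a : ℕ} (hab : a + T ≤ r) (hya : y ∈ ball G.graph v a)
    (hy : y ∈ ball G.graph v r) : A.output T H g (e.iso ⟨y, hy⟩) = A.output T G f y := by
  obtain ⟨e', he'⟩ := e.exists_restrict he hab hya hy rfl
  have hsub : ∀ z ∈ ball G.graph y T, z ∈ ball G.graph v r := fun z hz =>
    ball_mono hab _ (mem_ball_add hya hz)
  have hiff : (ball G.graph y T).Finite ↔ (ball H.graph (e.iso ⟨y, hy⟩ : W) T).Finite :=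
    e'.iso.toEquiv.finite_iff
  unfold LocalAlgorithm.output
  by_cases hfin : (ball G.graph y T).Finite
  · rw [dif_pos hfin, dif_pos (hiff.1 hfin)]
    congr 1
    refine (ballClass_eq e' (Subtype.ext ?_) (fun x => ?_) _ _).symm
    · exact he' _ hy
    · rw [he' x (hsub x x.2), hfg]
  · rw [dif_neg hfin, dif_neg fun h => hfin (hiff.2 h)]

end BallIso

/-- The coloring produced by `A` from the random seeds `θ` violates the constraint of `P` at `v`. -/
def LCL.Fails (P : LCL.{u}) (A : LocalAlgorithm.{u}) (T : ℕ) {ℓ : ℕ} {V : Type u}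
    (G : StructuredGraph V) (v : V) (θ : V → Fin ℓ) : Prop :=
  ¬ ∃ h : (ball G.graph v P.radius).Finite,
    P.check (ballClass G (A.output T G fun x => (θ x : ℕ)) v P.radius h) = true

/-- The constraint inspects outputs within `P.radius` of the root, and each output inspects seeds
within a further `T`. -/
theorem LCL.fails_iff (P : LCL.{u}) (A : LocalAlgorithm.{u}) {T : ℕ} {ℓ : ℕ} {V W : Type u}
    {G : StructuredGraph V} {H : StructuredGraph W} {v : V} {w : W} {r : ℕ} (hr : T + P.radius ≤ r)
    (e : StructuredIso (G.induce (ball G.graph v r)) (H.induce (ball H.graph w r)))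
    (he : e.iso ⟨v, mem_ball_self G.graph v r⟩ = ⟨w, mem_ball_self H.graph w r⟩)
    {θ : V → Fin ℓ} {η : W → Fin ℓ} (hθ : ∀ x, η (e.iso x) = θ x) :
    P.Fails A T H w η ↔ P.Fails A T G v θ := by
  obtain ⟨e', he'⟩ := e.exists_restrict he (a := 0) (b := P.radius) (by omega)
    (mem_ball_self _ _ _) (mem_ball_self _ _ _) (congrArg Subtype.val he)
  have hsub : ∀ z ∈ ball G.graph v P.radius, z ∈ ball G.graph v r := fun z hz =>
    ball_mono (by omega) _ hz
  have hiff : (ball G.graph v P.radius).Finite ↔ (ball H.graph w P.radius).Finite :=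
    e'.iso.toEquiv.finite_iff
  refine not_congr ?_
  have key : ∀ h h', ballClass H (A.output T H fun x => (η x : ℕ)) w P.radius h' =
      ballClass G (A.output T G fun x => (θ x : ℕ)) v P.radius h := by
    refine fun h h' => (ballClass_eq e' (Subtype.ext ?_) (fun x => ?_) _ _).symm
    · rw [he' _ (mem_ball_self _ _ _), he]
    · rw [he' x (hsub x x.2)]
      exact e.output_eq he A (fun x => by rw [hθ]) (by omega) x.2 _
  constructor
  · rintro ⟨h', hc⟩
    exact ⟨hiff.2 h', by rw [← key (hiff.2 h') h']; exact hc⟩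
  · rintro ⟨h, hc⟩
    exact ⟨hiff.1 h, by rw [key h (hiff.1 h)]; exact hc⟩

/-! ### Conditional failure probabilities -/

/-- The identity isomorphism. -/
def StructuredIso.refl {V : Type u} (G : StructuredGraph V) : StructuredIso G G :=
  ⟨SimpleGraph.Iso.refl, fun _ => rfl⟩

/-- The probability that the constraint of `P` at `v` is violated when the seeds on `U` are given
by `ζ` and all other seeds are chosen at random. -/
def LCL.condFail (P : LCL.{u}) (A : LocalAlgorithm.{u}) (T : ℕ) {ℓ : ℕ} [NeZero ℓ] {V : Type u}
    (G : StructuredGraph V) (U : Set V) (ζ : V → Fin ℓ) (v : V) : ℝ :=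
  (unif ℓ V).real {g | P.Fails A T G v (mix U ζ g)}

theorem mix_mix {V C : Type*} (U W : Set V) (a b c : V → C) :
    mix U a (mix W b c) = mix (U ∪ W) (mix U a b) c := by
  ext x
  by_cases hU : x ∈ U <;> by_cases hW : x ∈ W <;> simp [mix, hU, hW]

section CondFail

variable {P : LCL.{u}} {A : LocalAlgorithm.{u}} {T r : ℕ} {ℓ : ℕ} [NeZero ℓ] {V W : Type u}
  {G : StructuredGraph V} {H : StructuredGraph W}

/-- Failure is determined by finitely many coordinates, which the isomorphism matches up. With `U`
empty this transfers the failure bound from a finite graph to `G`; with `G = H` it gives the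
invariance behind Borelness. -/
theorem condFail_eq_of_iso (hr : T + P.radius ≤ r) {v : V} {w : W}
    (e : StructuredIso (G.induce (ball G.graph v r)) (H.induce (ball H.graph w r)))
    (he : e.iso ⟨v, mem_ball_self G.graph v r⟩ = ⟨w, mem_ball_self H.graph w r⟩)
    (hfin : (ball G.graph v r).Finite) {U : Set V} {U' : Set W} {ζ : V → Fin ℓ} {ζ' : W → Fin ℓ}
    (hU : ∀ x : ball G.graph v r, (e.iso x : W) ∈ U' ↔ (x : V) ∈ U)
    (hζ : ∀ x : ball G.graph v r, (x : V) ∈ U → ζ' (e.iso x) = ζ x) :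
    P.condFail A T H U' ζ' w = P.condFail A T G U ζ v := by
  have := hfin.to_subtype
  refine congrArg ENNReal.toReal (unif_eq_of_correspond (F := ball G.graph v r)
    (i := fun x => (e.iso x : W)) (j := fun x => (x : V))
    (Subtype.val_injective.comp e.iso.injective) Subtype.val_injective fun a b hab => ?_)
  refine P.fails_iff A hr e he fun x => ?_
  by_cases hx : (x : V) ∈ U
  · rw [mix_of_mem _ _ hx, mix_of_mem _ _ ((hU x).2 hx), hζ x hx]
  · rw [mix_of_notMem _ _ hx, mix_of_notMem _ _ (mt (hU x).1 hx)]
    exact congrFun hab x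

theorem condFail_congr (hr : T + P.radius ≤ r) {v : V} (hfin : (ball G.graph v r).Finite)
    {U U' : Set V} {ζ ζ' : V → Fin ℓ} (hU : ∀ x ∈ ball G.graph v r, x ∈ U' ↔ x ∈ U)
    (hζ : ∀ x ∈ ball G.graph v r, x ∈ U → ζ' x = ζ x) :
    P.condFail A T G U' ζ' v = P.condFail A T G U ζ v :=
  condFail_eq_of_iso hr (StructuredIso.refl _) rfl hfin (fun x => hU x x.2) fun x => hζ x x.2

theorem fails_congr {ℓ : ℕ} (hr : T + P.radius ≤ r) {v : V} {θ η : V → Fin ℓ}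
    (h : ∀ x ∈ ball G.graph v r, η x = θ x) : P.Fails A T G v η ↔ P.Fails A T G v θ :=
  P.fails_iff A hr (StructuredIso.refl _) rfl fun x => h x x.2

/-- On a finite graph, the probability of failure at one vertex is at most the probability that
the algorithm does not produce a coloring. -/
theorem condFail_empty_le (H : FinStructuredGraph.{u}) (x : H.V) (ζ : H.V → Fin ℓ) :
    P.condFail A T H.G ∅ ζ x ≤ 1 - successProb P A T ℓ H := by
  have := H.finite
  set S : Set (H.V → Fin ℓ) := {θ | P.IsColoring H.G (A.output T H.G fun x => (θ x : ℕ))}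
  have h1 : successProb P A T ℓ H = (unif ℓ H.V).real S := (unif_apply_of_finite S).symm
  have h2 : {g | P.Fails A T H.G x (mix ∅ ζ g)} ⊆ Sᶜ := by
    intro g hg hS
    have : mix ∅ ζ g = g := funext fun y => mix_of_notMem _ _ (notMem_empty y)
    rw [mem_ofPred_eq, this] at hg
    exact hg (hS x)
  rw [h1, ← probReal_compl_eq_one_sub (Set.toFinite S).measurableSet]
  exact measureReal_mono h2

variable [MeasurableSpace V] [StandardBorelSpace V]

theorem measurableSet_condFail_lt (hr : T + P.radius ≤ r) (hG : G.IsBorel)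
    (hfin : ∀ v, (ball G.graph v r).Finite) {K : ℕ} (hcard : ∀ v, (ball G.graph v r).ncard ≤ K)
    (hmr : MeasurableSet {p : V × V | p.2 ∈ ball G.graph p.1 r})
    {U : Set V} (hU : MeasurableSet U) {ζ : V → Fin ℓ} (hζ : Measurable ζ) (q : ℝ) :
    MeasurableSet {v | P.condFail A T G U ζ v < q} := by
  classical
  -- One label encodes both membership in `U` and the seed there; the shift by one reserves `0` for
  -- vertices outside `U`.
  have hf : Measurable fun v => if v ∈ U then (ζ v : ℕ) + 1 else 0 :=
    Measurable.ite hU ((measurable_of_finite fun i : Fin ℓ => (i : ℕ) + 1).comp hζ) measurable_const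
  refine measurableSet_of_ball_invariant hG hf hfin hcard hmr fun v v' e he hl hv => ?_
  rwa [condFail_eq_of_iso hr e he (hfin v) (U := U) (ζ := ζ) (fun x => ?_) fun x hx => ?_]
  · have := hl x
    split_ifs at this <;> simp_all
  · have := hl x
    rw [if_pos hx] at this
    split_ifs at this
    exact Fin.ext (by omega)

end CondFail

/-! ### Saturations under component-finite Borel graphs -/

/-- The vertices of `W` from which `D` can be reached inside `W` by at most `m` jumps of length at
most `N`. -/
def spread {V : Type u} (G : SimpleGraph V) (N : ℕ) (W D : Set V) : ℕ → Set V
  | 0 => D ∩ W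
  | m + 1 => spread G N W D m ∪ {x | x ∈ W ∧ ∃ y, y ∈ spread G N W D m ∧ y ∈ ball G x N}

/-- The union of the stages is thus the saturation of `D ∩ W` under the components of `G^N[W]`,
while each single stage is visibly Borel. -/
theorem mem_iUnion_spread_iff {V : Type u} {G : SimpleGraph V} {N : ℕ} {W D : Set V} {x : V} :
    x ∈ ⋃ m, spread G N W D m ↔ ∃ (hx : x ∈ W) (y : V) (hy : y ∈ W), y ∈ D ∧
      ((power G N).induce W).Reachable ⟨x, hx⟩ ⟨y, hy⟩ := by
  rw [mem_iUnion]
  constructor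
  · rintro ⟨m, hm⟩
    induction m generalizing x with
    | zero => exact ⟨hm.2, x, hm.2, hm.1, .rfl⟩
    | succ m ih =>
      rcases hm with hm | ⟨hx, y, hy, hyx⟩
      · exact ih hm
      · obtain ⟨hyW, z, hz, hzD, hyz⟩ := ih hy
        refine ⟨hx, z, hz, hzD, .trans ?_ hyz⟩
        by_cases hxy : x = y
        · subst hxy; exact .rfl
        · exact SimpleGraph.Adj.reachable (show (power G N).Adj x y from ⟨hxy, hyx⟩)
  · rintro ⟨hx, y, hy, hyD, ⟨p⟩⟩
    suffices h : ∀ a b : W, ((power G N).induce W).Walk a b → (b : V) ∈ D →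
        ∃ m, (a : V) ∈ spread G N W D m from h _ _ p hyD
    intro a b p hb
    induction p with
    | nil => exact ⟨0, hb, Subtype.prop _⟩
    | @cons a c b hadj p ih =>
      obtain ⟨m, hm⟩ := ih hb
      exact ⟨m + 1, Or.inr ⟨a.2, c, hm, hadj.2⟩⟩

theorem measurableSet_spread {V : Type u} [MeasurableSpace V] [StandardBorelSpace V]
    {G : SimpleGraph V} {N K : ℕ} (hfin : ∀ v, (ball G v N).Finite)
    (hcard : ∀ v, (ball G v N).ncard ≤ K) (hm : MeasurableSet {p : V × V | p.2 ∈ ball G p.1 N})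
    {W D : Set V} (hW : MeasurableSet W) (hD : MeasurableSet D) (m : ℕ) :
    MeasurableSet (spread G N W D m) := by
  induction m with
  | zero => exact hD.inter hW
  | succ m ih =>
    refine ih.union (hW.inter (measurableSet_proj_of_ncard_le K
      (E := {p : V × V | p.2 ∈ spread G N W D m ∧ p.2 ∈ ball G p.1 N})
      ((measurable_snd ih).inter hm) (fun v => (hfin v).subset fun _ h => h.2)
      fun v => (ncard_le_ncard (fun _ h => h.2) (hfin v)).trans (hcard v)))

/-! ### Coloring one piece of the partition -/

section Step

variable {P : LCL.{u}} {A : LocalAlgorithm.{u}} {T r : ℕ} {ℓ : ℕ} [NeZero ℓ] {V : Type u}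
  {G : StructuredGraph V} {Δ : ℕ}

/-- On a finite component of `W`, the local lemma provides seeds that increase the conditional
failure probabilities by a factor less than `e Δ`. -/
theorem exists_seeds_of_finite (hr : T + P.radius ≤ r)
    (hfin : ∀ v, (ball G.graph v (2 * r)).Finite) (hΔ : 0 < Δ)
    (hcard : ∀ v, (ball G.graph v (2 * r)).ncard ≤ Δ) {U W : Set V} {ζ : V → Fin ℓ} {q : ℝ}
    (hq : 0 < q) (hζ : ∀ v, P.condFail A T G U ζ v ≤ q) {N : Set V} (hN : N.Finite) :
    ∃ h : V → Fin ℓ, ∀ v ∈ N,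
      P.condFail A T G (U ∪ W) (mix U ζ h) v < Real.exp 1 * Δ * q := by
  classical
  have hfin' : ∀ v, (ball G.graph v r).Finite := fun v =>
    (hfin v).subset (ball_mono (by omega) v)
  set B : V → Set (V → Fin ℓ) := fun v =>
    {h | Real.exp 1 * Δ * q ≤ P.condFail A T G (U ∪ W) (mix U ζ h) v}
  have hdep : ∀ (v : V) (a b : V → Fin ℓ), (∀ x ∈ ball G.graph v r, a x = b x) →
      a ∈ B v → b ∈ B v := by
    intro v a b hab ha
    have : P.condFail A T G (U ∪ W) (mix U ζ b) v = P.condFail A T G (U ∪ W) (mix U ζ a) v :=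
      condFail_congr hr (hfin' v) (fun _ _ => Iff.rfl) fun x hx _ => by
        by_cases hxU : x ∈ U <;> simp [mix, hxU, hab x hx]
    simpa only [B, mem_ofPred_eq, this] using ha
  have hB : ∀ v, MeasurableSet (B v) := fun v => measurableSet_of_dependsOn (hfin' v) (hdep v)
  have hΔ' : (0 : ℝ) < Δ := by exact_mod_cast hΔ
  have hD : ((Δ - 1 : ℕ) : ℝ) + 1 = Δ := by
    rw [Nat.cast_sub hΔ]; simp
  suffices hne : (⋂ v ∈ hN.toFinset, (B v)ᶜ).Nonempty by
    obtain ⟨h, hh⟩ := hne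
    exact ⟨h, fun v hv => not_le.1 (mem_iInter₂.1 hh v (hN.mem_toFinset.2 hv))⟩
  -- The event `B v` reads seeds in the `r`-ball around `v`, and such balls are disjoint for centers
  -- more than `2r` apart. Not counting `v` itself, at most `Δ - 1` neighbours remain.
  refine symmetric_lovasz_local_lemma (μ := unif ℓ V) hB
    (fun v => ball G.graph v (2 * r)) (D := Δ - 1) (fun v S hvS hS => ?_) (fun v S hS => ?_)
    (fun v => ?_) hN.toFinset
  · have h1 : ((insert v S : Finset V) : Set V).ncard ≤ Δ := by
      refine (ncard_le_ncard ?_ (hfin v)).trans (hcard v)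
      rw [Finset.coe_insert]
      exact insert_subset (mem_ball_self _ _ _) hS
    rw [ncard_coe_finset, Finset.card_insert_of_notMem hvS] at h1
    omega
  · refine unif_inter_of_complementary (ball G.graph v r) (hB v)
      (.biInter S.countable_toSet fun j _ => (hB j).compl) (hdep v) fun a b hab ha => ?_
    refine mem_iInter₂.2 fun j hj hbj => mem_iInter₂.1 ha j hj ?_
    refine hdep j b a (fun x hx => (hab x fun hxv => hS j hj ?_).symm) hbj
    rw [two_mul]
    exact mem_ball_add hxv (mem_ball_comm.1 hx)
  · have hBm : MeasurableSet {g : V → Fin ℓ | P.Fails A T G v (mix U ζ g)} :=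
      measurableSet_of_dependsOn (hfin' v) fun a b hab ha => by
        refine (fails_congr hr fun x hx => ?_).2 ha
        by_cases hxU : x ∈ U <;> simp [mix, hxU, hab x hx]
    -- Markov's inequality gives `q / (e Δ q) = 1 / (e Δ)`, exactly the local lemma threshold.
    have := unif_conditional_ge_le W hBm (q := Real.exp 1 * Δ * q) (by positivity) (hζ v)
    simp only [mem_ofPred_eq, mix_mix] at this
    refine this.trans_eq ?_
    rw [hD]
    field_simp

variable [MeasurableSpace V] [StandardBorelSpace V]

/-- Extending the seeds from `U` to `U ∪ W`, where the components of `W` are finite, in a Borel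
way, at the cost of a factor less than `e Δ` in the conditional failure probabilities. -/
theorem exists_borel_seeds_union (hr : T + P.radius ≤ r) (hG : G.IsBorel)
    (hfin : ∀ v, (ball G.graph v (2 * r)).Finite) (hΔ : 0 < Δ)
    (hcard : ∀ v, (ball G.graph v (2 * r)).ncard ≤ Δ) {U W : Set V} (hU : MeasurableSet U)
    (hW : MeasurableSet W) (hcomp : ComponentFinite ((power G.graph (2 * r)).induce W))
    {ζ : V → Fin ℓ} (hζm : Measurable ζ) {q : ℝ} (hq : 0 < q)
    (hζ : ∀ v, P.condFail A T G U ζ v ≤ q) :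
    ∃ ζ' : V → Fin ℓ, Measurable ζ' ∧
      ∀ v, P.condFail A T G (U ∪ W) ζ' v < Real.exp 1 * Δ * q := by
  classical
  set q' := Real.exp 1 * Δ * q
  have hsub : ∀ v, ball G.graph v r ⊆ ball G.graph v (2 * r) := fun v => ball_mono (by omega) v
  have hfin' : ∀ v, (ball G.graph v r).Finite := fun v => (hfin v).subset (hsub v)
  have hcard' : ∀ v, (ball G.graph v r).ncard ≤ Δ := fun v =>
    (ncard_le_ncard (hsub v) (hfin v)).trans (hcard v)
  have hm1 := measurableSet_mem_ball hG.adj hfin hcard (r := r) (by omega)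
  have hm2 := measurableSet_mem_ball hG.adj hfin hcard le_rfl
  obtain ⟨f, hf, hfC⟩ := exists_dense_colorings V ℓ
  have hmix : ∀ θ : V → Fin ℓ, Measurable θ → Measurable (mix U ζ θ) := fun θ hθ =>
    Measurable.ite hU hζm hθ
  let bad : ℕ → Set V := fun k => {v | P.condFail A T G (U ∪ W) (mix U ζ (f k)) v < q'}ᶜ
  have hbad : ∀ k, MeasurableSet (bad k) := fun k =>
    (measurableSet_condFail_lt hr hG hfin' hcard' hm1 (hU.union hW) (hmix _ (hf k)) q').compl
  let D : ℕ → Set V := fun k => {x | ∃ v, v ∈ bad k ∧ v ∈ ball G.graph x r}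
  have hD : ∀ k, MeasurableSet (D k) := fun k => measurableSet_proj_of_ncard_le Δ
    (E := {p : V × V | p.2 ∈ bad k ∧ p.2 ∈ ball G.graph p.1 r})
    ((measurable_snd (hbad k)).inter hm1) (fun v => (hfin' v).subset fun _ h => h.2)
    fun v => (ncard_le_ncard (fun _ h => h.2) (hfin' v)).trans (hcard' v)
  -- The union of the components of `W` on which `f k` is unsuitable, having a bad vertex within
  -- distance `r`.
  let sat : ℕ → Set V := fun k => ⋃ m, spread G.graph (2 * r) W (D k) m
  have hsat : ∀ k, MeasurableSet (sat k) := fun k =>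
    .iUnion fun m => measurableSet_spread hfin hcard hm2 hW (hD k) m
  have hreach : ∀ {v x y : V} (hx : x ∈ W) (hy : y ∈ W), v ∈ ball G.graph x r →
      y ∈ ball G.graph v r → ((power G.graph (2 * r)).induce W).Reachable ⟨x, hx⟩ ⟨y, hy⟩ := by
    intro v x y hx hy hv hyv
    by_cases hxy : x = y
    · subst hxy; exact .rfl
    · refine SimpleGraph.Adj.reachable (show (power G.graph (2 * r)).Adj x y from ⟨hxy, ?_⟩)
      rw [two_mul]
      exact mem_ball_add hv hyv
  have hex : ∀ x, ∃ k, x ∉ sat k := by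
    intro x
    by_cases hx : x ∈ W
    swap
    · exact ⟨0, fun h => hx (mem_iUnion_spread_iff.1 h).1⟩
    set C : Set V := Subtype.val ''
      (((power G.graph (2 * r)).induce W).connectedComponentMk ⟨x, hx⟩).supp
    have hC : C.Finite := (hcomp _).image _
    have hCmem : ∀ {y} (hy : y ∈ W), ((power G.graph (2 * r)).induce W).Reachable ⟨x, hx⟩ ⟨y, hy⟩ →
        y ∈ C := fun hy hxy =>
      ⟨⟨_, hy⟩, SimpleGraph.ConnectedComponent.sound hxy.symm, rfl⟩
    -- Only these finitely many vertices can see the component `C`, so a finite local lemma is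
    -- enough to show that some `f k` suits it.
    have hN : (⋃ c ∈ C, ball G.graph c r).Finite := hC.biUnion fun c _ => hfin' c
    obtain ⟨h, hh⟩ := exists_seeds_of_finite hr hfin hΔ hcard (W := W) hq hζ hN
    obtain ⟨k, hk⟩ := hfC C hC h
    refine ⟨k, fun hxk => ?_⟩
    obtain ⟨_, y, hy, ⟨v, hvbad, hvy⟩, hxy⟩ := mem_iUnion_spread_iff.1 hxk
    refine hvbad ?_
    have h1 := hh v (mem_biUnion (hCmem hy hxy) hvy)
    rwa [mem_ofPred_eq, condFail_congr hr (hfin' v) (fun _ _ => Iff.rfl) fun z hz hzUW => ?_]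
    by_cases hzU : z ∈ U
    · simp [mix, hzU]
    · have hzW : z ∈ W := hzUW.resolve_left hzU
      simp [mix, hzU, hk z (hCmem hzW (hxy.trans (hreach hy hzW hvy hz)))]
  let κ : V → ℕ := fun x => Nat.find (hex x)
  have hθ : Measurable fun x => f (κ x) x :=
    Measurable.find (p := fun k x => x ∉ sat k) hf (fun k => (hsat k).compl) hex
  -- The least suitable index is constant on components, so near any vertex the patched seeds agree
  -- with a single `f k`.
  have hκ : ∀ {x y : V} (hx : x ∈ W) (hy : y ∈ W),
      ((power G.graph (2 * r)).induce W).Reachable ⟨x, hx⟩ ⟨y, hy⟩ → κ x = κ y := by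
    intro x y hx hy hxy
    have : ∀ k, x ∉ sat k ↔ y ∉ sat k := by
      refine fun k => not_congr (mem_iUnion_spread_iff.trans (Iff.trans ?_
        mem_iUnion_spread_iff.symm))
      constructor
      · rintro ⟨_, z, hz, hzD, hxz⟩; exact ⟨hy, z, hz, hzD, hxy.symm.trans hxz⟩
      · rintro ⟨_, z, hz, hzD, hyz⟩; exact ⟨hx, z, hz, hzD, hxy.trans hyz⟩
    exact Nat.find_congr' (this _)
  refine ⟨mix U ζ fun x => f (κ x) x, hmix _ hθ, fun v => ?_⟩
  by_cases hv : ∃ x ∈ ball G.graph v r, x ∈ W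
  · obtain ⟨x, hxv, hx⟩ := hv
    have hgood : P.condFail A T G (U ∪ W) (mix U ζ (f (κ x))) v < q' := by
      by_contra hbad
      refine Nat.find_spec (hex x) (mem_iUnion_spread_iff.2 ⟨hx, x, hx, ⟨v, hbad, ?_⟩, .rfl⟩)
      exact mem_ball_comm.1 hxv
    rwa [condFail_congr hr (hfin' v) (fun _ _ => Iff.rfl) fun z hz hzUW => ?_]
    by_cases hzU : z ∈ U
    · simp [mix, hzU]
    · have hzW : z ∈ W := hzUW.resolve_left hzU
      simp [mix, hzU, hκ hx hzW (hreach hx hzW (mem_ball_comm.1 hxv) hz)]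
  -- No seed visible from `v` is newly fixed, so the conditional probability is unchanged; the bound
  -- stays strict because `e Δ > 1`.
  · push Not at hv
    rw [condFail_congr hr (hfin' v) (U := U) (ζ := ζ)
      (fun z hz => by simp [hv z hz]) fun z hz hzU => mix_of_mem _ _ hzU]
    refine (hζ v).trans_lt ?_
    have h1 : (1 : ℝ) < Real.exp 1 * Δ := by
      have h2 : (1 : ℝ) ≤ Δ := by exact_mod_cast hΔ
      have h3 : (1 : ℝ) < Real.exp 1 := by simp
      nlinarith
    exact lt_mul_of_one_lt_left hq h1

end Step

/-! ### Assembling the coloring -/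

theorem exists_le_of_iInf_le {p : ℕ → Prop} {m : ℕ} (h : ⨅ (t : ℕ) (_ : p t), (t : ℕ∞) ≤ m) :
    ∃ t ≤ m, p t := by
  by_contra! hne
  have : ((m + 1 : ℕ) : ℕ∞) ≤ ⨅ (t : ℕ) (_ : p t), (t : ℕ∞) :=
    le_iInf₂ fun t ht => by
      exact_mod_cast Nat.lt_of_not_le fun htm => hne t htm ht
  have := this.trans h
  norm_cast at this
  omega

section Assemble

variable {P : LCL.{u}} {A : LocalAlgorithm.{u}} {T r : ℕ} {ℓ : ℕ} [NeZero ℓ] {V : Type u}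
  {G : StructuredGraph V} {Δ : ℕ} [MeasurableSpace V] [StandardBorelSpace V]

/-- Borel seeds that make the algorithm succeed everywhere. -/
theorem exists_borel_seeds (hr : T + P.radius ≤ r) (hG : G.IsBorel)
    (hfin : ∀ v, (ball G.graph v (2 * r)).Finite) (hΔ : 0 < Δ)
    (hcard : ∀ v, (ball G.graph v (2 * r)).ncard ≤ Δ) {s : ℕ}
    (hsep : HasSeparation (power G.graph (2 * r)) s) {p : ℝ} (hp : 0 < p)
    (hpΔ : (Real.exp 1 * Δ) ^ (s + 1) * p ≤ 1)
    (hfail : ∀ (ζ : V → Fin ℓ) v, P.condFail A T G ∅ ζ v ≤ p) :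
    ∃ ζ : V → Fin ℓ, Measurable ζ ∧ ∀ v, ¬ P.Fails A T G v ζ := by
  obtain ⟨c, hc, hcomp⟩ := hsep
  have hΔ' : (0 : ℝ) < Δ := by exact_mod_cast hΔ
  have hcU : ∀ i : ℕ, MeasurableSet {x | (c x : ℕ) < i} := fun i =>
    hc (Set.toFinite {j : Fin (s + 1) | (j : ℕ) < i}).measurableSet
  -- The strict bound is what finally excludes a probability equal to `1`; it is available only once
  -- a piece has been treated.
  have hstep : ∀ i ≤ s + 1, ∃ ζ : V → Fin ℓ, Measurable ζ ∧
      (∀ v, P.condFail A T G {x | (c x : ℕ) < i} ζ v ≤ (Real.exp 1 * Δ) ^ i * p) ∧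
      (0 < i → ∀ v, P.condFail A T G {x | (c x : ℕ) < i} ζ v < (Real.exp 1 * Δ) ^ i * p) := by
    intro i
    induction i with
    | zero => exact fun _ => ⟨fun _ => 0, measurable_const, fun v => by simpa using hfail _ v,
        fun h => absurd h (lt_irrefl 0)⟩
    | succ i ih =>
      intro hi
      have hunion : {x | (c x : ℕ) < i + 1} = {x | (c x : ℕ) < i} ∪ c ⁻¹' {⟨i, hi⟩} := by
        ext x
        simp only [mem_ofPred_eq, mem_union, mem_preimage, mem_singleton_iff, Fin.ext_iff]
        omega
      obtain ⟨ζ, hζm, hζ, -⟩ := ih (by omega)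
      obtain ⟨ζ', hζm', hζ'⟩ := exists_borel_seeds_union hr hG hfin hΔ hcard (hcU i)
        (hc (measurableSet_singleton _)) (hcomp ⟨i, hi⟩) hζm (by positivity) hζ
      rw [hunion, pow_succ', mul_assoc]
      exact ⟨ζ', hζm', fun v => (hζ' v).le, fun _ => hζ'⟩
  obtain ⟨ζ, hζm, -, hζ⟩ := hstep (s + 1) le_rfl
  refine ⟨ζ, hζm, fun v hv => ?_⟩
  have huniv : {x | (c x : ℕ) < s + 1} = univ := eq_univ_of_forall fun x => (c x).2
  have h1 := (hζ s.succ_pos v).trans_le hpΔ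
  rw [huniv, LCL.condFail] at h1
  -- With all seeds fixed, a failure at `v` would have probability `1`.
  have h2 : {g : V → Fin ℓ | P.Fails A T G v (mix univ ζ g)} = univ := by
    refine eq_univ_of_forall fun g => ?_
    have : mix univ ζ g = ζ := funext fun y => mix_of_mem _ _ (mem_univ y)
    simpa only [mem_ofPred_eq, this] using hv
  rw [h2, probReal_univ] at h1
  exact lt_irrefl _ h1

theorem measurable_output (hr : T ≤ r) (hG : G.IsBorel)
    (hfin : ∀ v, (ball G.graph v (2 * r)).Finite)
    (hcard : ∀ v, (ball G.graph v (2 * r)).ncard ≤ Δ) {f : V → ℕ} (hf : Measurable f) :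
    Measurable (A.output T G f) := by
  have hsub : ∀ v, ball G.graph v r ⊆ ball G.graph v (2 * r) := fun v => ball_mono (by omega) v
  refine measurable_to_countable' fun k => ?_
  refine measurableSet_of_ball_invariant hG hf (fun v => (hfin v).subset (hsub v))
    (fun v => (ncard_le_ncard (hsub v) (hfin v)).trans (hcard v))
    (measurableSet_mem_ball hG.adj hfin hcard (by omega)) fun v v' e he hl hv => ?_
  have := e.output_eq he A hl (a := 0) (T := T) (by omega) (mem_ball_self _ _ _)
    (mem_ball_self _ _ _)
  rw [he] at this
  exact this.trans hv

end Assemble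

end BorelLocal

end

/-! ### Derivation of the theorem from the existence of Borel seeds -/

theorem theorem3p6
    (P : BorelLocal.LCL.{u}) (𝔾 : Set BorelLocal.FinStructuredGraph.{u})
    (n : ℕ) (hn : 0 < n) (hRand : BorelLocal.randComplexity P 𝔾 n < ⊤)
    (Rstar : ℕ) (hRstar : (Rstar : ℕ∞) = BorelLocal.randComplexity P 𝔾 n + (P.radius : ℕ∞))
    {V : Type u} [MeasurableSpace V] [StandardBorelSpace V]
    (G : BorelLocal.StructuredGraph V) (hG : G.IsBorel)
    (hloc : BorelLocal.LocallyIn G Rstar n 𝔾)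
    (s : ℕ) (hasi : BorelLocal.asi G.graph ≤ (s : ℕ∞))
    (hball : ∀ v : V, (BorelLocal.ball G.graph v (2 * Rstar)).Finite ∧
      ((BorelLocal.ball G.graph v (2 * Rstar)).ncard : ℝ) ≤
        (n : ℝ) ^ (1 / ((s : ℝ) + 1)) / Real.exp 1) :
    ∃ f : V → ℕ, Measurable f ∧ P.IsColoring G f := by
  open BorelLocal in
  -- A vertex is needed to know that the size bound `Δ` below is positive.
  rcases isEmpty_or_nonempty V with hV | ⟨⟨v₀⟩⟩
  · exact ⟨fun _ => 0, measurable_const, fun v => hV.elim v⟩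
  obtain ⟨T₀, hT₀⟩ := ENat.ne_top_iff_exists.1 hRand.ne
  obtain ⟨T, hT, ℓ, hℓ, A, hA⟩ := exists_le_of_iInf_le (p := SolvableInTime P 𝔾 n) hT₀.ge
  have hr : T + P.radius ≤ Rstar := by
    rw [← hT₀] at hRstar
    norm_cast at hRstar
    omega
  have : NeZero ℓ := ⟨hℓ.ne'⟩
  obtain ⟨s', hs', hsep⟩ := exists_le_of_iInf_le
    (p := HasSeparation (power G.graph (2 * Rstar))) ((le_iSup (fun R => si (power G.graph R)) _).trans hasi)
  have hn' : (0 : ℝ) < n := by exact_mod_cast hn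
  set Δ : ℕ := ⌊(n : ℝ) ^ (1 / ((s : ℝ) + 1)) / Real.exp 1⌋₊
  have hfin := fun v => (hball v).1
  have hcard : ∀ v, (ball G.graph v (2 * Rstar)).ncard ≤ Δ := fun v => Nat.le_floor (hball v).2
  have hΔ : 0 < Δ := lt_of_lt_of_le
    ((Set.ncard_pos (hfin v₀)).2 ⟨v₀, mem_ball_self _ _ _⟩) (hcard v₀)
  have hΔ' : (1 : ℝ) ≤ Δ := by exact_mod_cast hΔ
  have hpow : (Real.exp 1 * Δ) ^ (s' + 1) * (1 / (n : ℝ)) ≤ 1 := by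
    have h1 : Real.exp 1 * Δ ≤ (n : ℝ) ^ (1 / ((s : ℝ) + 1)) := by
      rw [mul_comm, ← le_div_iff₀ (Real.exp_pos 1)]
      exact Nat.floor_le (by positivity)
    -- The partition may have only `s' + 1 ≤ s + 1` pieces; with base at least `1` the exponent can
    -- be raised to `s + 1`.
    have h2 : (1 : ℝ) ≤ Real.exp 1 * Δ := by nlinarith [Real.one_le_exp zero_le_one]
    have h3 : (Real.exp 1 * Δ) ^ (s' + 1) ≤ n := by
      calc (Real.exp 1 * Δ) ^ (s' + 1) ≤ (Real.exp 1 * Δ) ^ (s + 1) :=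
            pow_le_pow_right₀ h2 (by omega)
        _ ≤ ((n : ℝ) ^ (1 / ((s : ℝ) + 1))) ^ (s + 1) := pow_le_pow_left₀ (by linarith) h1 _
        _ = n := by
            rw [← Real.rpow_natCast, ← Real.rpow_mul hn'.le]
            push_cast
            rw [one_div_mul_cancel (by positivity), Real.rpow_one]
    rw [mul_one_div, div_le_one hn']
    exact h3
  obtain ⟨ζ, hζm, hζ⟩ := exists_borel_seeds (A := A) (ℓ := ℓ) hr hG hfin hΔ hcard hsep
    (p := 1 / (n : ℝ)) (by positivity) hpow fun ζ v => by
      obtain ⟨H, hH, hHn, x, e, he⟩ := hloc v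
      have h1 : P.condFail A T H.G ∅ (fun _ => (0 : Fin ℓ)) x = P.condFail A T G ∅ ζ v :=
        condFail_eq_of_iso hr e he ((hfin v).subset (ball_mono (by omega) v)) (fun _ => Iff.rfl)
          fun _ h => h.elim
      have h2 := condFail_empty_le (P := P) (A := A) (T := T) H x fun _ => (0 : Fin ℓ)
      have h3 := hA H hH hHn
      linarith
  refine ⟨A.output T G fun x => (ζ x : ℕ), measurable_output (by omega) hG hfin hcard
    ((measurable_of_finite _).comp hζm), fun v => not_not.1 (hζ v)⟩
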